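/- Let $\mathbb H^2$ be the hyperbolic plane of curvature $-1$ with a fixed origin $o$, and give $\mathbb H^2\times\mathbb R$ the Riemannian product metric $\langle\cdot,\cdot\rangle$, with vertical unit Killing field $\partial_z$. A translating soliton is an immersed surface of class $C^2$ (possibly with boundary) with a continuous unit normal field $\eta$ whose mean curvature $H=\tfrac12(\kappa_1+\kappa_2)$ with respect to $\eta$ satisfies $H=\langle\eta,\partial_z\rangle$ at every point. A bowl soliton is a translating soliton that is the entire vertical graph of a function $u:\mathbb H^2\to\mathbb R$, is invariant under rotations around the vertical axis over $o$, and is oriented upwards, $\langle\eta,\partial_z\rangle>0$. For $s\ge 0$ its height $\tau(s)$ is the distance from the vertex (the point over $o$) to $\mathbb H^2\times\{0\}$, after the vertical translation which puts the circle of the graph over $C(o,s)$ in $\mathbb H^2\times\{0\}$; that is, $\tau(s)=|u(q)-u(o)|$ for any $q$ at distance $s$ from $o$. Theorem. Bowl solitons exist, and for every bowl soliton the following holds, with $\tau$ its height function. Let $\Gamma$ be a closed curve of diameter $\sigma$ contained in a horizontal plane $\mathbb H^2\times\{t_0\}$, and let $M$ be a compact, connected surface with boundary, immersed in $\mathbb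 H^2\times\mathbb R$ as a translating soliton (of class $C^2$ up to the boundary) with $\partial M=\Gamma$, i.e. the image of the boundary is $\Gamma$. Then for every $p\in M$ the distance from (the image of) $p$ to $\mathbb H^2\times\{t_0\}$ is at most $\tau(2\sigma)$. -/

import Mathlib

open scoped Manifold ContDiff

noncomputable section

namespace TranslatingSoliton

/-- The Lorentzian scalar product `x₁y₁ + x₂y₂ - x₃y₃` of Lorentz-Minkowski space `𝕃³`. -/
def lor (v w : Fin 3 → ℝ) : ℝ := v 0 * w 0 + v 1 * w 1 - v 2 * w 2

/-- The hyperbolic plane `ℍ²`, in the hyperboloid model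
`{x ∈ 𝕃³ : x₁² + x₂² - x₃² = -1, x₃ > 0}`. -/
abbrev HypPlane : Type := {x : Fin 3 → ℝ // lor x x = -1 ∧ 0 < x 2}

/-- The linear space `𝕃³ × ℝ`, in which `ℍ² × ℝ` is a hypersurface. -/
abbrev Ambient : Type := (Fin 3 → ℝ) × ℝ

/-- The scalar product `⟨·,·⟩` of `𝕃³ × ℝ`. On the tangent spaces of `ℍ² × ℝ` it is the product
metric `g_{ℍ²} + dz²`. -/
def prodForm (v w : Ambient) : ℝ := lor v.1 w.1 + v.2 * w.2

/-- The inclusion of `ℍ² × ℝ` in `𝕃³ × ℝ`. -/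
def incl (q : HypPlane × ℝ) : Ambient := (q.1.1, q.2)

/-- The unit vertical Killing field `∂_z`. -/
def vertical : Ambient := (0, 1)

/-! ### Distances -/

/-- The hyperbolic distance, `cosh d(p, q) = -⟨p, q⟩`. -/
def hypDist (p q : HypPlane) : ℝ := Real.arcosh (-(lor p.1 q.1))

/-- The distance of the Riemannian product `ℍ² × ℝ`. -/
def prodDist (p q : HypPlane × ℝ) : ℝ := √(hypDist p.1 q.1 ^ 2 + (p.2 - q.2) ^ 2)

/-- The diameter of a subset of `ℍ² × ℝ` (used for nonempty bounded sets). -/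
def diameter (S : Set (HypPlane × ℝ)) : ℝ := sSup {d | ∃ p ∈ S, ∃ q ∈ S, d = prodDist p q}

/-- The distance from a point to a nonempty subset of `ℍ² × ℝ`. -/
def distToSet (p : HypPlane × ℝ) (S : Set (HypPlane × ℝ)) : ℝ := sInf (prodDist p '' S)

/-- The horizontal plane `ℍ² × {t}`. -/
def slice (t : ℝ) : Set (HypPlane × ℝ) := {q | q.2 = t}

/-- A closed curve: the trace of a continuous map from the circle. -/
def IsClosedCurve (Γ : Set (HypPlane × ℝ)) : Prop :=
  ∃ γ : Circle → HypPlane × ℝ, Continuous γ ∧ Set.range γ = Γ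

/-! ### Immersed surfaces and translating solitons

`M` is a surface, possibly with boundary, modelled on `I` (which will be `𝓡 2` or `𝓡∂ 2`), and
`ψ : M → ℍ² × ℝ` a map. Derivatives are taken in the preferred chart of `M` around `p`, within
the range of the model, that is, one-sided at boundary points. -/

section Surface

variable {H : Type*} [TopologicalSpace H]
  (I : ModelWithCorners ℝ (EuclideanSpace ℝ (Fin 2)) H)
  {M : Type*} [TopologicalSpace M] [ChartedSpace H M]
  (ψ : M → HypPlane × ℝ)

/-- The map `ψ`, seen in `𝕃³ × ℝ`, in the chart around `p`. -/
def localRep (p : M) (x : EuclideanSpace ℝ (Fin 2)) : Ambient :=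
  incl (ψ ((extChartAt I p).symm x))

/-- The coordinate vector field `∂_j ψ` in the chart around `p`. -/
def partialDeriv (p : M) (j : Fin 2) (x : EuclideanSpace ℝ (Fin 2)) : Ambient :=
  fderivWithin ℝ (localRep I ψ p) (Set.range I) x (EuclideanSpace.single j 1)

/-- The coordinate vector `∂_j ψ` at `p`. -/
def frame (p : M) (j : Fin 2) : Ambient := partialDeriv I ψ p j (extChartAt I p p)

/-- The second derivative `∂_i ∂_j ψ` at `p`, in the linear space `𝕃³ × ℝ`. -/
def secondDeriv (p : M) (i j : Fin 2) : Ambient :=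
  fderivWithin ℝ (partialDeriv I ψ p j) (Set.range I) (extChartAt I p p)
    (EuclideanSpace.single i 1)

/-- The first fundamental form `g_{ij} = ⟨∂_i ψ, ∂_j ψ⟩` at `p`. -/
def firstForm (p : M) : Matrix (Fin 2) (Fin 2) ℝ :=
  Matrix.of fun i j => prodForm (frame I ψ p i) (frame I ψ p j)

/-- The second fundamental form at `p` with respect to a vector `n` that is tangent to `ℍ² × ℝ`
and normal to the surface. As `∂_i ∂_j ψ` and the covariant derivative of `∂_j ψ` along `∂_i ψ`
in `ℍ² × ℝ` differ by a multiple of the normal of `ℍ² × ℝ` in `𝕃³ × ℝ`, to which `n` is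
orthogonal, both have the same product with `n`. -/
def secondForm (p : M) (n : Ambient) : Matrix (Fin 2) (Fin 2) ℝ :=
  Matrix.of fun i j => prodForm (secondDeriv I ψ p i j) n

/-- The mean curvature at `p` with respect to `n`: half the trace of the second fundamental
form with respect to the first one, `2 H = κ₁ + κ₂`. -/
def meanCurvature (p : M) (n : Ambient) : ℝ :=
  (1 / 2) * ((firstForm I ψ p)⁻¹ * secondForm I ψ p n).trace

/-- `ψ` is an immersion of class `C²`. -/
structure IsImmersedSurface : Prop where
  contMDiff : ContMDiff I 𝓘(ℝ, Ambient) 2 (fun p => incl (ψ p))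
  immersion : ∀ p, LinearIndependent ℝ (frame I ψ p)

/-- `η` is a (continuous, globally defined) unit normal field in `ℍ² × ℝ` along `ψ`. -/
structure IsUnitNormal (η : M → Ambient) : Prop where
  continuous : Continuous η
  tangent : ∀ p, lor (η p).1 (ψ p).1.1 = 0
  normal : ∀ p j, prodForm (η p) (frame I ψ p j) = 0
  unit : ∀ p, prodForm (η p) (η p) = 1

/-- `ψ` is a translating soliton with unit normal `η`: an immersed surface whose mean curvature
with respect to `η` is everywhere the angle function `⟨η, ∂_z⟩`. -/
structure IsTranslatingSolitonWith (η : M → Ambient) : Prop where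
  surface : IsImmersedSurface I ψ
  unitNormal : IsUnitNormal I ψ η
  soliton : ∀ p, meanCurvature I ψ p (η p) = prodForm (η p) vertical

/-- `ψ` is a translating soliton (in particular, an orientable immersed surface). -/
def IsTranslatingSoliton : Prop := ∃ η : M → Ambient, IsTranslatingSolitonWith I ψ η

end Surface

/-! ### The bowl soliton -/

/-- The origin `(0, 0, 1)` of `ℍ²`. -/
def origin : HypPlane := ⟨![0, 0, 1], by simp [lor], by simp⟩

/-- The rotation of `ℍ²` by the angle `θ` around the origin. -/
def rot (θ : ℝ) (p : HypPlane) : HypPlane :=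
  ⟨![Real.cos θ * p.1 0 - Real.sin θ * p.1 1, Real.sin θ * p.1 0 + Real.cos θ * p.1 1, p.1 2], by
    have h := p.2.1
    simp only [lor, Matrix.cons_val_zero, Matrix.cons_val_one, Matrix.cons_val] at h ⊢
    linear_combination h + (p.1 0 ^ 2 + p.1 1 ^ 2) * Real.sin_sq_add_cos_sq θ, by
    simpa using p.2.2⟩

/-- The point `(sinh s, 0, cosh s)`, which for `s ≥ 0` lies on the circle `C(0, s)` of radius `s`
around the origin. -/
def circlePoint (s : ℝ) : HypPlane :=
  ⟨![Real.sinh s, 0, Real.cosh s], by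
    simp only [lor, Matrix.cons_val_zero, Matrix.cons_val_one, Matrix.cons_val]
    linear_combination -(Real.cosh_sq s), by
    simpa using Real.cosh_pos s⟩

/-- The global parametrization `(x₁, x₂) ↦ (x₁, x₂, √(1 + x₁² + x₂²))` of `ℍ²`. -/
def hypParam (x : EuclideanSpace ℝ (Fin 2)) : HypPlane :=
  ⟨![x 0, x 1, √(1 + x 0 ^ 2 + x 1 ^ 2)], by
    have h : √(1 + x 0 ^ 2 + x 1 ^ 2) * √(1 + x 0 ^ 2 + x 1 ^ 2) = 1 + x 0 ^ 2 + x 1 ^ 2 :=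
      Real.mul_self_sqrt (by positivity)
    simp only [lor, Matrix.cons_val_zero, Matrix.cons_val_one, Matrix.cons_val]
    linear_combination -h, by
    have h : 0 < √(1 + x 0 ^ 2 + x 1 ^ 2) := Real.sqrt_pos.2 (by positivity)
    simpa using h⟩

/-- The parametrization of the entire vertical graph `{(p, u p) : p ∈ ℍ²}`. -/
def graphParam (u : HypPlane → ℝ) (x : EuclideanSpace ℝ (Fin 2)) : HypPlane × ℝ :=
  (hypParam x, u (hypParam x))

/-- The graph of `u` is a bowl soliton: an entire vertical graph that is rotationally symmetric
around the vertical axis through the origin and is an upwards-oriented translating soliton. -/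
structure IsBowlSoliton (u : HypPlane → ℝ) : Prop where
  rotational : ∀ θ p, u (rot θ p) = u p
  soliton : ∃ η : EuclideanSpace ℝ (Fin 2) → Ambient,
    IsTranslatingSolitonWith (𝓡 2) (graphParam u) η ∧ ∀ x, 0 < prodForm (η x) vertical

/-- The height `τ(s)` of the compact piece with boundary circle of radius `s` of the bowl soliton
that is the graph of `u`: translate the graph vertically so that the circle over `C(0, s)` is in
`ℍ² × {0}`, and take the distance of the vertex (the point over the origin) to `ℍ² × {0}`. -/
def bowlHeight (u : HypPlane → ℝ) (s : ℝ) : ℝ :=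
  distToSet (origin, u origin - u (circlePoint s)) (slice 0)

end TranslatingSoliton

end

open TranslatingSoliton

noncomputable section

namespace TranslatingSoliton

/-! ### Linear algebra of `𝕃³ × ℝ` -/

/-! Write `z` for the height and `f = -⟨·, o⟩ = cosh d(o, ·)`, and compare a soliton with rotational
graphs `z = G(f)`. At a critical point of `z - G(f)` restricted to the surface, the trace of the
Hessian is a positive multiple of `defect (G' f) (G'' f) f`, whatever the choice of the unit normal
(`trace_hessian_eq`). Hence no interior local minimum of `z - G(f)` occurs where the defect is
negative, and no interior local maximum where it is positive. Only strict barriers are used, so the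
second derivative test replaces the strong maximum principle.

Three explicit barriers give the estimate. The constant `G = 0` has positive defect, so `z ≤ t₀` on
`M`. With `o` on `Γ`, `G = 2 log f` has negative defect, and `f ≤ cosh σ` on `Γ`, so `z ≥ t₀ - 2 log
cosh σ`. Finally `G = log (f + 1)` has positive defect; compared with a bowl over a disc it gives
`τ(s) ≥ log ((cosh s + 1) / 2)`. At `s = 2σ` the right side is exactly `2 log cosh σ`. The bowl
itself is never used as a barrier, so the estimate needs neither its uniqueness nor its profile.

For existence, a zero of the defect is a singular first order equation for `G'` in the variable `f`.
It is solved on the whole half-line by a weighted contraction after truncation, and a barrier shows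
that the truncation is inactive (`exists_profile`). The graph of the integral `G` of this solution
is a bowl. -/

theorem lor_self_nonneg {X v : Fin 3 → ℝ} (hX : lor X X = -1) (hv : lor v X = 0) :
    v 0 ^ 2 + v 1 ^ 2 ≤ X 2 ^ 2 * lor v v := by
  simp only [lor] at *
  have h1 : v 2 * X 2 = v 0 * X 0 + v 1 * X 1 := by linarith
  have h2 : X 2 ^ 2 * (v 2 * v 2) = (v 0 * X 0 + v 1 * X 1) ^ 2 := by rw [← h1]; ring
  -- Cauchy-Schwarz in the plane, with `X₃² = 1 + X₁² + X₂²`: vectors tangent to the hyperboloid are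
  -- spacelike.
  nlinarith [sq_nonneg (v 0 * X 1 - v 1 * X 0)]

theorem prodForm_self_nonneg {X : Fin 3 → ℝ} {w : Ambient} (hX : lor X X = -1)
    (hw : lor w.1 X = 0) : 0 ≤ prodForm w w := by
  have h := lor_self_nonneg hX hw
  have hX2 : 1 ≤ X 2 ^ 2 := by
    simp only [lor] at hX
    nlinarith [sq_nonneg (X 0), sq_nonneg (X 1)]
  have h3 : 0 ≤ lor w.1 w.1 := by
    by_contra hneg
    nlinarith [sq_nonneg (w.1 0), sq_nonneg (w.1 1)]
  simp only [prodForm]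
  nlinarith [sq_nonneg w.2]

theorem eq_zero_of_prodForm_self {X : Fin 3 → ℝ} {w : Ambient} (hX : lor X X = -1)
    (hw : lor w.1 X = 0) (h0 : prodForm w w = 0) : w = 0 := by
  have h := lor_self_nonneg hX hw
  have hX2 : 1 ≤ X 2 ^ 2 := by
    simp only [lor] at hX
    nlinarith [sq_nonneg (X 0), sq_nonneg (X 1)]
  have h3 : 0 ≤ lor w.1 w.1 := by
    by_contra hneg
    nlinarith [sq_nonneg (w.1 0), sq_nonneg (w.1 1)]
  have h4 : lor w.1 w.1 = 0 := by
    simp only [prodForm] at h0; nlinarith [sq_nonneg w.2]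
  have h5 : w.2 = 0 := by
    simp only [prodForm, h4] at h0; nlinarith [sq_nonneg w.2]
  rw [h4, mul_zero] at h
  have h6 : w.1 0 = 0 := by nlinarith [sq_nonneg (w.1 0), sq_nonneg (w.1 1)]
  have h7 : w.1 1 = 0 := by nlinarith [sq_nonneg (w.1 0), sq_nonneg (w.1 1)]
  have h8 : w.1 2 = 0 := by
    simp only [lor, h6, h7] at h4
    nlinarith [sq_nonneg (w.1 2)]
  ext i
  · fin_cases i <;> simp [h6, h7, h8]
  · simpa using h5

theorem prodForm_comm (v w : Ambient) : prodForm v w = prodForm w v := by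
  simp only [prodForm, lor]; ring

theorem prodForm_add_left (u v w : Ambient) :
    prodForm (u + v) w = prodForm u w + prodForm v w := by
  simp only [prodForm, lor, Prod.fst_add, Prod.snd_add, Pi.add_apply]; ring

theorem prodForm_smul_left (a : ℝ) (v w : Ambient) : prodForm (a • v) w = a * prodForm v w := by
  simp only [prodForm, lor, Prod.smul_fst, Prod.smul_snd, Pi.smul_apply, smul_eq_mul]; ring

theorem lor_add_left (u v w : Fin 3 → ℝ) : lor (u + v) w = lor u w + lor v w := by
  simp only [lor, Pi.add_apply]; ring

theorem lor_smul_left (a : ℝ) (v w : Fin 3 → ℝ) : lor (a • v) w = a * lor v w := by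
  simp only [lor, Pi.smul_apply, smul_eq_mul]; ring

theorem lor_comm (v w : Fin 3 → ℝ) : lor v w = lor w v := by
  simp only [lor]; ring

theorem one_le_neg_lor {p q : Fin 3 → ℝ} (hp : lor p p = -1) (hp' : 0 < p 2)
    (hq : lor q q = -1) (hq' : 0 < q 2) : 1 ≤ -lor p q := by
  simp only [lor] at *
  have h1 : (p 0 * q 0 + p 1 * q 1 + 1) ^ 2 ≤ (p 2 * q 2) ^ 2 := by
    have hp2 : p 2 ^ 2 = 1 + p 0 ^ 2 + p 1 ^ 2 := by linarith
    have hq2 : q 2 ^ 2 = 1 + q 0 ^ 2 + q 1 ^ 2 := by linarith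
    rw [mul_pow, hp2, hq2]
    nlinarith [sq_nonneg (p 0 * q 1 - p 1 * q 0), sq_nonneg (p 0 - q 0), sq_nonneg (p 1 - q 1)]
  have h2 := abs_le_of_sq_le_sq h1 (by positivity)
  linarith [(abs_le.1 h2).2]

/-- The data of an immersed surface in `ℍ² × ℝ` at a point: the position `X` in `ℍ²`, two
independent tangent vectors and a unit normal. -/
structure IsFrame (X : Fin 3 → ℝ) (P : Fin 2 → Ambient) (η : Ambient) : Prop where
  position : lor X X = -1
  tangent : ∀ i, lor (P i).1 X = 0
  independent : LinearIndependent ℝ P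
  normal_tangent : lor η.1 X = 0
  normal : ∀ i, prodForm η (P i) = 0
  unit : prodForm η η = 1

namespace IsFrame

variable {X : Fin 3 → ℝ} {P : Fin 2 → Ambient} {η : Ambient}

theorem gram_left_pos (h : IsFrame X P η) (ξ : Fin 2 → ℝ) (hξ : ξ ≠ 0) :
    0 < ξ 0 ^ 2 * prodForm (P 0) (P 0) + 2 * (ξ 0 * ξ 1) * prodForm (P 0) (P 1)
      + ξ 1 ^ 2 * prodForm (P 1) (P 1) := by
  have e : prodForm (ξ 0 • P 0 + ξ 1 • P 1) (ξ 0 • P 0 + ξ 1 • P 1) =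
      ξ 0 ^ 2 * prodForm (P 0) (P 0) + 2 * (ξ 0 * ξ 1) * prodForm (P 0) (P 1)
      + ξ 1 ^ 2 * prodForm (P 1) (P 1) := by
    simp only [prodForm, lor, Prod.smul_fst, Prod.smul_snd, Pi.smul_apply, smul_eq_mul,
      Prod.fst_add, Prod.snd_add, Pi.add_apply]
    ring
  have ht : lor (ξ 0 • P 0 + ξ 1 • P 1).1 X = 0 := by
    simp only [Prod.fst_add, Prod.smul_fst, lor_add_left, lor_smul_left, h.tangent]; ring
  rw [← e]
  refine lt_of_le_of_ne (prodForm_self_nonneg h.position ht) fun h0 => hξ ?_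
  have hz := eq_zero_of_prodForm_self h.position ht h0.symm
  have := Fintype.linearIndependent_iff.1 h.independent ξ (by simpa [Fin.sum_univ_two] using hz)
  exact funext this

theorem gram_zero_pos (h : IsFrame X P η) : 0 < prodForm (P 0) (P 0) := by
  simpa using h.gram_left_pos ![1, 0] (by intro h; simpa using congrFun h 0)

theorem gram_det_pos (h : IsFrame X P η) :
    0 < prodForm (P 0) (P 0) * prodForm (P 1) (P 1) - prodForm (P 0) (P 1) ^ 2 := by
  have h0 := h.gram_zero_pos
  -- At `(-g₀₁, g₀₀)` the quadratic form equals `g₀₀` times the Gram determinant.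
  have h1 := h.gram_left_pos ![-prodForm (P 0) (P 1), prodForm (P 0) (P 0)]
    (by intro h; have := congrFun h 1; simp at this; exact h0.ne' this)
  simp only [Matrix.cons_val_zero, Matrix.cons_val_one] at h1
  by_contra hn
  nlinarith

/-- A vector tangent to `ℍ² × ℝ` and orthogonal to the normal is tangent to the surface. -/
theorem exists_combination (h : IsFrame X P η) {w : Ambient} (hw : lor w.1 X = 0)
    (hη : prodForm η w = 0) : ∃ a b : ℝ, w = a • P 0 + b • P 1 := by
  -- The position vector is normal to `ℍ² × ℝ`, so together with the tangent vectors and `η` it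
  -- gives a basis of the four-dimensional space.
  let B : Fin 4 → Ambient := ![P 0, P 1, (X, 0), η]
  have hB : LinearIndependent ℝ B := by
    rw [Fintype.linearIndependent_iff]
    intro g hg
    simp only [Fin.sum_univ_four, B, Matrix.cons_val] at hg
    have hη' : g 3 = 0 := by
      have := congrArg (prodForm · η) hg
      simp only [prodForm_add_left, prodForm_smul_left] at this
      rw [prodForm_comm (P 0), prodForm_comm (P 1), h.normal, h.normal, h.unit] at this
      have e : prodForm (X, 0) η = 0 := by
        have := h.normal_tangent
        rw [lor_comm] at this
        simp [prodForm, this]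
      have e0 : prodForm 0 η = 0 := by simp [prodForm, lor]
      rw [e, e0] at this
      linarith
    have hX' : g 2 = 0 := by
      have := congrArg (fun v : Ambient => lor v.1 X) hg
      simp only [Prod.fst_add, Prod.smul_fst, lor_add_left, lor_smul_left, h.tangent,
        h.normal_tangent, h.position] at this
      have e0 : lor (0 : Ambient).1 X = 0 := by simp [lor]
      rw [e0] at this
      linarith
    rw [hη', hX'] at hg
    have h2 := Fintype.linearIndependent_iff.1 h.independent ![g 0, g 1]
      (by simpa [Fin.sum_univ_two] using hg)
    intro i
    fin_cases i
    · simpa using h2 0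
    · simpa using h2 1
    · exact hX'
    · exact hη'
  have hspan : w ∈ Submodule.span ℝ (Set.range B) := by
    rw [hB.span_eq_top_of_card_eq_finrank (by simp)]
    trivial
  obtain ⟨g, hg⟩ := (Submodule.mem_span_range_iff_exists_fun ℝ).1 hspan
  simp only [Fin.sum_univ_four, B, Matrix.cons_val] at hg
  have hη' : g 3 = 0 := by
    have := congrArg (prodForm · η) hg
    simp only [prodForm_add_left, prodForm_smul_left] at this
    rw [prodForm_comm (P 0), prodForm_comm (P 1), prodForm_comm w, h.normal, h.normal, h.unit,
      hη] at this
    have e : prodForm (X, 0) η = 0 := by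
      have := h.normal_tangent
      rw [lor_comm] at this
      simp [prodForm, this]
    rw [e] at this
    linarith
  have hX' : g 2 = 0 := by
    have := congrArg (fun v : Ambient => lor v.1 X) hg
    simp only [Prod.fst_add, Prod.smul_fst, lor_add_left, lor_smul_left, h.tangent,
      h.normal_tangent, h.position, hw] at this
    linarith
  refine ⟨g 0, g 1, ?_⟩
  rw [← hg, hη', hX']
  simp

/-- If the differential of `z - G(f)`, `f = -⟨·, o⟩`, vanishes on the tangent plane, its gradient
`∂_z - G'(f) ∇f` is a multiple of the unit normal. -/
theorem gradient_eq (h : IsFrame X P η) {o : Fin 3 → ℝ} {a : ℝ}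
    (hcrit : ∀ i, (P i).2 = a * -lor (P i).1 o) :
    ((-a) • ((-lor X o) • X - o), (1 : ℝ)) =
      prodForm η ((-a) • ((-lor X o) • X - o), (1 : ℝ)) • η := by
  set n : Ambient := ((-a) • ((-lor X o) • X - o), (1 : ℝ)) with hn
  have hnX : lor n.1 X = 0 := by
    have := h.position
    simp only [hn, lor, Pi.smul_apply, Pi.sub_apply, smul_eq_mul] at this ⊢
    linear_combination (a * (X 0 * o 0 + X 1 * o 1 - X 2 * o 2)) * this
  have hnP : ∀ i, prodForm n (P i) = 0 := by
    intro i
    have h1 := h.tangent i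
    have h2 := hcrit i
    simp only [hn, prodForm, lor, Pi.smul_apply, Pi.sub_apply, smul_eq_mul] at h1 h2 ⊢
    linear_combination h2 + (a * (X 0 * o 0 + X 1 * o 1 - X 2 * o 2)) * h1
  set l := prodForm η n with hl
  -- The difference `n - l η` is tangent to the surface, yet orthogonal to both tangent vectors;
  -- positivity of the form forces it to vanish.
  have hwX : lor (n + (-l) • η).1 X = 0 := by
    simp only [Prod.fst_add, Prod.smul_fst, lor_add_left, lor_smul_left, hnX, h.normal_tangent]
    ring
  have hwη : prodForm η (n + (-l) • η) = 0 := by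
    rw [prodForm_comm, prodForm_add_left, prodForm_smul_left, h.unit, prodForm_comm n, ← hl]
    ring
  obtain ⟨b, c, hbc⟩ := h.exists_combination hwX hwη
  have hwP : ∀ i, prodForm (P i) (n + (-l) • η) = 0 := by
    intro i
    rw [prodForm_comm, prodForm_add_left, prodForm_smul_left, h.normal, hnP]
    ring
  have hw0 : prodForm (n + (-l) • η) (n + (-l) • η) = 0 := by
    conv_lhs => enter [1]; rw [hbc]
    rw [prodForm_add_left, prodForm_smul_left, prodForm_smul_left, hwP, hwP]
    ring
  have := eq_zero_of_prodForm_self h.position hwX hw0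
  rw [neg_smul, ← sub_eq_add_neg, sub_eq_zero] at this
  exact this

/-- The trace of the Hessian of `z - G(f)` at a critical point, in terms of the second
fundamental form; `a` and `b` are the first and second derivatives of `G`. -/
theorem trace_hessian (h : IsFrame X P η) {o : Fin 3 → ℝ} (ho : lor o o = -1) {a b : ℝ}
    (hcrit : ∀ i, (P i).2 = a * -lor (P i).1 o) {S : Fin 2 → Fin 2 → Ambient}
    (hS : ∀ i j, lor (S i j).1 X = -lor (P i).1 (P j).1)
    {Q : Fin 2 → Fin 2 → ℝ}
    (hQ : ∀ i j, Q i j = (S i j).2 - a * -lor (S i j).1 o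
      - b * (-lor (P i).1 o * -lor (P j).1 o)) :
    ∃ l : ℝ, l * η.2 = 1 ∧ l ^ 2 = 1 + a ^ 2 * (lor X o ^ 2 - 1) ∧
      l ^ 2 * (prodForm (P 1) (P 1) * Q 0 0 - prodForm (P 0) (P 1) * (Q 0 1 + Q 1 0)
        + prodForm (P 0) (P 0) * Q 1 1) =
      l ^ 3 * (prodForm (P 1) (P 1) * prodForm (S 0 0) η
        - prodForm (P 0) (P 1) * (prodForm (S 0 1) η + prodForm (S 1 0) η)
        + prodForm (P 0) (P 0) * prodForm (S 1 1) η)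
      - (prodForm (P 0) (P 0) * prodForm (P 1) (P 1) - prodForm (P 0) (P 1) ^ 2) *
        (b * (lor X o ^ 2 - 1) + a * -lor X o * (2 + a ^ 2 * (lor X o ^ 2 - 1))) := by
  have hgrad := h.gradient_eq hcrit
  set l := prodForm η ((-a) • ((-lor X o) • X - o), (1 : ℝ)) with hl
  have hl1 : l * η.2 = 1 := by
    have := congrArg Prod.snd hgrad
    simpa using this.symm
  have hl2 : l ^ 2 = 1 + a ^ 2 * (lor X o ^ 2 - 1) := by
    have h1 : prodForm (l • η) (l • η) = l ^ 2 := by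
      rw [prodForm_smul_left, prodForm_comm, prodForm_smul_left, h.unit]; ring
    rw [← h1, ← hgrad]
    have h2 := h.position
    simp only [prodForm, lor, Pi.smul_apply, Pi.sub_apply, smul_eq_mul] at h2 ho ⊢
    linear_combination (a ^ 2 * (X 0 * o 0 + X 1 * o 1 - X 2 * o 2) ^ 2) * h2 + a ^ 2 * ho
  -- This is `Hess f = f g_{ℍ²}` on `ℍ²`. The term `a³ f` appears because at the critical point
  -- `g_{ℍ²}(Pᵢ, Pⱼ) = gᵢⱼ - a² fᵢ fⱼ`.
  have hsec : ∀ i j, l * prodForm (S i j) η = Q i j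
      + (b - a ^ 3 * -lor X o) * (-lor (P i).1 o * -lor (P j).1 o)
      + a * -lor X o * prodForm (P i) (P j) := by
    intro i j
    have h1 : l * prodForm (S i j) η = prodForm (l • η) (S i j) := by
      rw [prodForm_smul_left, prodForm_comm]
    rw [h1, ← hgrad, hQ]
    have h2 := hS i j
    have h3 := hcrit i
    have h4 := hcrit j
    have h5 : (P i).2 * (P j).2 = (a * -lor (P i).1 o) * (a * -lor (P j).1 o) := by rw [h3, h4]
    simp only [prodForm, h5]
    simp only [lor, Pi.smul_apply, Pi.sub_apply, smul_eq_mul] at h2 ⊢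
    linear_combination (a * (X 0 * o 0 + X 1 * o 1 - X 2 * o 2)) * h2
  -- the tangential part of the gradient of `f`
  set f := -lor X o with hf
  set v : Ambient := (f • X - o, 0) with hv
  set w : Ambient := l ^ 2 • v + (a * (f ^ 2 - 1)) • (l • η) with hw
  have hvX : lor v.1 X = 0 := by
    have := h.position
    simp only [hv, hf, lor, Pi.smul_apply, Pi.sub_apply, smul_eq_mul] at this ⊢
    linear_combination -(X 0 * o 0 + X 1 * o 1 - X 2 * o 2) * this
  have hvv : prodForm v v = f ^ 2 - 1 := by
    have := h.position
    simp only [hv, hf, prodForm, lor, Pi.smul_apply, Pi.sub_apply, smul_eq_mul] at this ho ⊢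
    linear_combination (X 0 * o 0 + X 1 * o 1 - X 2 * o 2) ^ 2 * this + ho
  have hvη : l * prodForm η v = -a * (f ^ 2 - 1) := by
    rw [← prodForm_smul_left, ← hgrad, ← hvv]
    simp only [hv, prodForm, lor, Pi.smul_apply, Pi.sub_apply, smul_eq_mul]
    ring
  have hvP : ∀ i, prodForm v (P i) = -lor (P i).1 o := by
    intro i
    have := h.tangent i
    simp only [hv, prodForm, lor, Pi.smul_apply, Pi.sub_apply, smul_eq_mul] at this ⊢
    linear_combination f * this
  have hff : lor X o ^ 2 = f ^ 2 := by rw [hf]; ring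
  rw [hff] at hl2 ⊢
  have hwX : lor w.1 X = 0 := by
    simp only [hw, Prod.fst_add, Prod.smul_fst, lor_add_left, lor_smul_left, hvX,
      h.normal_tangent]
    ring
  have hwη : prodForm η w = 0 := by
    rw [hw, prodForm_comm, prodForm_add_left, prodForm_smul_left, prodForm_smul_left,
      prodForm_smul_left, h.unit, prodForm_comm v]
    linear_combination l * hvη
  have hwP : ∀ i, prodForm w (P i) = l ^ 2 * -lor (P i).1 o := by
    intro i
    rw [hw, prodForm_add_left, prodForm_smul_left, prodForm_smul_left, prodForm_smul_left,
      h.normal, hvP]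
    ring
  have hwv : prodForm w v = f ^ 2 - 1 := by
    rw [hw, prodForm_add_left, prodForm_smul_left, prodForm_smul_left, prodForm_smul_left,
      hvη, hvv, hl2]
    ring
  obtain ⟨c, d, hcd⟩ := h.exists_combination hwX hwη
  have k0 := hwP 0
  have k1 := hwP 1
  have k2 := hwv
  have hPP : prodForm (P 1) (P 0) = prodForm (P 0) (P 1) := prodForm_comm _ _
  rw [hcd, prodForm_add_left, prodForm_smul_left, prodForm_smul_left] at k0 k1 k2
  rw [prodForm_comm (P 0) v, prodForm_comm (P 1) v, hvP, hvP] at k2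
  rw [hPP] at k0
  have s00 := hsec 0 0
  have s01 := hsec 0 1
  have s10 := hsec 1 0
  have s11 := hsec 1 1
  rw [hPP] at s10
  generalize prodForm (P 0) (P 0) = g00 at *
  generalize prodForm (P 0) (P 1) = g01 at *
  generalize prodForm (P 1) (P 1) = g11 at *
  generalize -lor (P 0).1 o = f0 at *
  generalize -lor (P 1).1 o = f1 at *
  -- The trace of `df ⊗ df` on the surface is the squared norm of the tangential gradient of `f`,
  -- which is `w / l²`; this norm squared is `(f² - 1) / l²`.
  have htr : l ^ 2 * (g11 * f0 ^ 2 - 2 * g01 * f0 * f1 + g00 * f1 ^ 2)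
      = (g00 * g11 - g01 ^ 2) * (f ^ 2 - 1) := by
    linear_combination (g00 * g11 - g01 ^ 2) * k2 - (g11 * f0 - g01 * f1) * k0
      - (g00 * f1 - g01 * f0) * k1
  refine ⟨l, hl1, hl2, ?_⟩
  linear_combination -(l ^ 2 * g11) * s00 + l ^ 2 * g01 * (s01 + s10) - l ^ 2 * g00 * s11
    - (b - a ^ 3 * f) * htr - 2 * a * f * (g00 * g11 - g01 ^ 2) * hl2

end IsFrame

/-! ### Derivatives of height and distance functions along a surface -/

theorem hasDerivAt_fst_apply {γ : ℝ → Ambient} {v : Ambient} {s : ℝ} (h : HasDerivAt γ v s)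
    (i : Fin 3) : HasDerivAt (fun s => (γ s).1 i) (v.1 i) s := by
  have := ((ContinuousLinearMap.proj (R := ℝ) (φ := fun _ : Fin 3 => ℝ) i).comp
    (ContinuousLinearMap.fst ℝ (Fin 3 → ℝ) ℝ)).hasFDerivAt.comp_hasDerivAt s h
  exact this

theorem hasDerivAt_snd_apply {γ : ℝ → Ambient} {v : Ambient} {s : ℝ} (h : HasDerivAt γ v s) :
    HasDerivAt (fun s => (γ s).2) v.2 s :=
  (ContinuousLinearMap.snd ℝ (Fin 3 → ℝ) ℝ).hasFDerivAt.comp_hasDerivAt s h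

theorem hasDerivAt_lor {γ δ : ℝ → Ambient} {v w : Ambient} {s : ℝ} (h : HasDerivAt γ v s)
    (h' : HasDerivAt δ w s) : HasDerivAt (fun s => lor (γ s).1 (δ s).1)
      (lor v.1 (δ s).1 + lor (γ s).1 w.1) s := by
  have e := (((hasDerivAt_fst_apply h 0).mul (hasDerivAt_fst_apply h' 0)).add
    ((hasDerivAt_fst_apply h 1).mul (hasDerivAt_fst_apply h' 1))).sub
    ((hasDerivAt_fst_apply h 2).mul (hasDerivAt_fst_apply h' 2))
  refine e.congr_deriv ?_
  simp only [lor]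
  ring

theorem hasDerivAt_lor_const {γ : ℝ → Ambient} {v : Ambient} {s : ℝ} (h : HasDerivAt γ v s)
    (o : Fin 3 → ℝ) : HasDerivAt (fun s => -lor (γ s).1 o)
      (-lor v.1 o) s := by
  have := (hasDerivAt_lor h (hasDerivAt_const s ((o, 0) : Ambient))).neg
  refine this.congr_deriv ?_
  simp [lor]

/-- The second derivative is nonnegative at a local minimum. -/
theorem second_deriv_nonneg_of_isLocalMin {F F' : ℝ → ℝ} {d : ℝ}
    (h : ∀ᶠ s in nhds 0, HasDerivAt F (F' s) s) (h' : HasDerivAt F' d 0)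
    (hmin : IsLocalMin F 0) : 0 ≤ d := by
  by_contra hd
  push Not at hd
  have hF' : deriv F =ᶠ[nhds 0] F' := h.mono fun s hs => hs.deriv
  have h0 : F' 0 = 0 := (hmin.hasDerivAt_eq_zero h.self_of_nhds)
  -- If `d < 0`, the strict test makes `0` a local maximum too, so `F` is locally constant and `d =
  -- 0`.
  have hmax : IsLocalMin (fun s => -F s) 0 := by
    apply isLocalMin_of_deriv_deriv_pos
    · have e : deriv (fun s => -F s) =ᶠ[nhds 0] fun s => -F' s :=
        h.mono fun s hs => hs.neg.deriv
      have e' : deriv (fun s => -F' s) 0 = -d := h'.neg.deriv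
      rw [e.deriv_eq, e']
      linarith
    · have e' : deriv (fun s => -F s) 0 = -F' 0 := h.self_of_nhds.neg.deriv
      rw [e', h0, neg_zero]
    · exact h.self_of_nhds.neg.continuousAt
  have hc : F =ᶠ[nhds 0] fun _ => F 0 := by
    filter_upwards [hmin, hmax] with s h1 h2
    linarith
  have hz : F' =ᶠ[nhds 0] fun _ => 0 := by
    filter_upwards [hF', hc.eventuallyEq_nhds] with s h1 h2
    rw [← h1, h2.deriv_eq, deriv_const]
  have := h'.congr_of_eventuallyEq hz.symm
  have e := this.unique (hasDerivAt_const (0 : ℝ) (0 : ℝ))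
  linarith

/-- `a` and `b` are the first and second derivatives of `G` on `[1, ∞)`. -/
structure HasTwoDerivs (G a b : ℝ → ℝ) : Prop where
  first : ∀ c, 1 ≤ c → HasDerivWithinAt G (a c) (Set.Ici 1) c
  second : ∀ c, 1 ≤ c → HasDerivWithinAt a (b c) (Set.Ici 1) c

section Surface

variable {H : Type*} [TopologicalSpace H]
  {I : ModelWithCorners ℝ (EuclideanSpace ℝ (Fin 2)) H}
  {M : Type*} [TopologicalSpace M] [ChartedSpace H M]
  {ψ : M → HypPlane × ℝ}

/-! ### Second order calculus of an immersion in a chart -/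

theorem lor_localRep_self (p : M) (x : EuclideanSpace ℝ (Fin 2)) :
    lor (localRep I ψ p x).1 (localRep I ψ p x).1 = -1 :=
  (ψ ((extChartAt I p).symm x)).1.2.1

theorem one_le_neg_lor_localRep (o : HypPlane) (p : M) (x : EuclideanSpace ℝ (Fin 2)) :
    1 ≤ -lor (localRep I ψ p x).1 o.1 :=
  one_le_neg_lor (ψ ((extChartAt I p).symm x)).1.2.1 (ψ ((extChartAt I p).symm x)).1.2.2
    o.2.1 o.2.2

theorem localRep_self (p : M) : localRep I ψ p (extChartAt I p p) = incl (ψ p) := by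
  rw [localRep, extChartAt_to_inv]

theorem contDiffAt_localRep (h : ContMDiff I 𝓘(ℝ, Ambient) 2 (fun p => incl (ψ p))) {p : M}
    (hp : Set.range I ∈ nhds (extChartAt I p p)) :
    ContDiffAt ℝ 2 (localRep I ψ p) (extChartAt I p p) := by
  have := (contMDiffAt_iff.1 (h p)).2
  exact this.contDiffAt hp

/-- At interior points the range of the model is a neighbourhood, so the one-sided derivatives of
the definitions become ordinary ones. -/
theorem partialDeriv_eventuallyEq {p : M}
    (hp : Set.range I ∈ nhds (extChartAt I p p)) (j : Fin 2) :
    partialDeriv I ψ p j =ᶠ[nhds (extChartAt I p p)]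
      fun x => fderiv ℝ (localRep I ψ p) x (EuclideanSpace.single j 1) := by
  filter_upwards [eventually_mem_nhds_iff.2 hp] with x hx
  rw [partialDeriv, fderivWithin_of_mem_nhds hx]

theorem frame_eq {p : M} (hp : Set.range I ∈ nhds (extChartAt I p p)) (j : Fin 2) :
    frame I ψ p j = fderiv ℝ (localRep I ψ p) (extChartAt I p p) (EuclideanSpace.single j 1) :=
  (partialDeriv_eventuallyEq hp j).self_of_nhds

theorem secondDeriv_eq (h : ContMDiff I 𝓘(ℝ, Ambient) 2 (fun p => incl (ψ p))) {p : M}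
    (hp : Set.range I ∈ nhds (extChartAt I p p)) (i j : Fin 2) :
    secondDeriv I ψ p i j = fderiv ℝ (fderiv ℝ (localRep I ψ p)) (extChartAt I p p)
      (EuclideanSpace.single i 1) (EuclideanSpace.single j 1) := by
  have hd : DifferentiableAt ℝ (fderiv ℝ (localRep I ψ p)) (extChartAt I p p) :=
    ((contDiffAt_localRep h hp).fderiv_right (m := 1) (by norm_num)).differentiableAt one_ne_zero
  rw [secondDeriv, fderivWithin_of_mem_nhds hp, (partialDeriv_eventuallyEq hp j).fderiv_eq]
  rw [fderiv_clm_apply hd (differentiableAt_const _)]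
  simp

variable {L : EuclideanSpace ℝ (Fin 2) → Ambient} {x : EuclideanSpace ℝ (Fin 2)}

theorem hasDerivAt_line (hL : ContDiffAt ℝ 2 L x) (ξ : EuclideanSpace ℝ (Fin 2)) :
    ∀ᶠ s : ℝ in nhds 0, HasDerivAt (fun s : ℝ => L (x + s • ξ)) (fderiv ℝ L (x + s • ξ) ξ) s := by
  have hd : ∀ᶠ y in nhds x, DifferentiableAt ℝ L y :=
    (hL.eventually (by simp)).mono fun y hy => hy.differentiableAt two_ne_zero
  have hc : Filter.Tendsto (fun s : ℝ => x + s • ξ) (nhds 0) (nhds x) := by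
    have : Continuous (fun s : ℝ => x + s • ξ) := by fun_prop
    simpa using this.tendsto 0
  filter_upwards [hc.eventually hd] with s hs
  have hl : HasDerivAt (fun s : ℝ => x + s • ξ) ξ s := by
    simpa using ((hasDerivAt_id s).smul_const ξ).const_add x
  exact hs.hasFDerivAt.comp_hasDerivAt s hl

theorem hasDerivAt_fderiv_line (hL : ContDiffAt ℝ 2 L x) (ξ ζ : EuclideanSpace ℝ (Fin 2)) :
    HasDerivAt (fun s : ℝ => fderiv ℝ L (x + s • ξ) ζ) (fderiv ℝ (fderiv ℝ L) x ξ ζ) 0 := by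
  have hd : DifferentiableAt ℝ (fderiv ℝ L) x :=
    (hL.fderiv_right (m := 1) (by norm_num)).differentiableAt one_ne_zero
  have hl : HasDerivAt (fun s : ℝ => x + s • ξ) ξ 0 := by
    simpa using ((hasDerivAt_id (0 : ℝ)).smul_const ξ).const_add x
  have hd' : HasFDerivAt (fderiv ℝ L) (fderiv ℝ (fderiv ℝ L) x) (x + (0 : ℝ) • ξ) := by
    simpa using hd.hasFDerivAt
  have := hd'.comp_hasDerivAt (0 : ℝ) hl
  exact (ContinuousLinearMap.apply ℝ Ambient ζ).hasFDerivAt.comp_hasDerivAt (0 : ℝ) this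

theorem lor_fderiv_eq_zero (hL : DifferentiableAt ℝ L x) (h1 : ∀ y, lor (L y).1 (L y).1 = -1)
    (ξ : EuclideanSpace ℝ (Fin 2)) : lor (fderiv ℝ L x ξ).1 (L x).1 = 0 := by
  have hl : HasDerivAt (fun s : ℝ => x + s • ξ) ξ 0 := by
    simpa using ((hasDerivAt_id (0 : ℝ)).smul_const ξ).const_add x
  have hd' : HasFDerivAt L (fderiv ℝ L x) (x + (0 : ℝ) • ξ) := by simpa using hL.hasFDerivAt
  have h := hd'.comp_hasDerivAt (0 : ℝ) hl
  have h2 := hasDerivAt_lor h h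
  have h3 : HasDerivAt (fun s : ℝ => lor ((L ∘ fun s : ℝ => x + s • ξ) s).1
      ((L ∘ fun s : ℝ => x + s • ξ) s).1) 0 0 := by
    simp only [Function.comp, h1]
    exact hasDerivAt_const _ _
  have h4 := h2.unique h3
  simp only [Function.comp, zero_smul, add_zero] at h4
  rw [lor_comm (L x).1] at h4
  linarith

/-- Differentiates `⟨∂_ζ L, L⟩ = 0` along `ξ`. This is the hypothesis on `S` in
`IsFrame.trace_hessian`. -/
theorem lor_fderiv_fderiv (hL : ContDiffAt ℝ 2 L x) (h1 : ∀ y, lor (L y).1 (L y).1 = -1)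
    (ξ ζ : EuclideanSpace ℝ (Fin 2)) : lor (fderiv ℝ (fderiv ℝ L) x ξ ζ).1 (L x).1 =
      -lor (fderiv ℝ L x ξ).1 (fderiv ℝ L x ζ).1 := by
  have hd : ∀ᶠ y in nhds x, DifferentiableAt ℝ L y :=
    (hL.eventually (by simp)).mono fun y hy => hy.differentiableAt two_ne_zero
  have hc : Filter.Tendsto (fun s : ℝ => x + s • ξ) (nhds 0) (nhds x) := by
    have : Continuous (fun s : ℝ => x + s • ξ) := by fun_prop
    simpa using this.tendsto 0
  have h2 := hasDerivAt_lor (hasDerivAt_fderiv_line hL ξ ζ) (hasDerivAt_line hL ξ).self_of_nhds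
  have h3 : (fun s : ℝ => lor (fderiv ℝ L (x + s • ξ) ζ).1 (L (x + s • ξ)).1)
      =ᶠ[nhds 0] fun _ => 0 := by
    filter_upwards [hc.eventually hd] with s hs
    exact lor_fderiv_eq_zero hs h1 ζ
  have h4 := h2.unique ((hasDerivAt_const (0 : ℝ) (0 : ℝ)).congr_of_eventuallyEq h3)
  simp only [zero_smul, add_zero] at h4
  rw [lor_comm (fderiv ℝ L x ξ).1]
  linarith

variable {o : HypPlane} {G a b : ℝ → ℝ}

/-- A derivative of `G` within `[1, ∞)` suffices, even where `f = 1`, because `f ≥ 1` all along the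
curve. -/
theorem hasDerivAt_heightDiff (hG : HasTwoDerivs G a b) {γ : ℝ → Ambient} {v : Ambient} {s : ℝ}
    (h1 : ∀ s, 1 ≤ -lor (γ s).1 o.1) (h : HasDerivAt γ v s) :
    HasDerivAt (fun s => (γ s).2 - G (-lor (γ s).1 o.1))
      (v.2 - a (-lor (γ s).1 o.1) * -lor v.1 o.1) s := by
  have h2 := (hG.first _ (h1 s)).comp_hasDerivAt s (hasDerivAt_lor_const h o.1)
    (Filter.Eventually.of_forall h1)
  exact (hasDerivAt_snd_apply h).sub h2

theorem hasDerivAt_deriv_heightDiff (hG : HasTwoDerivs G a b) {γ γ' : ℝ → Ambient} {w : Ambient}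
    {s : ℝ} (h1 : ∀ s, 1 ≤ -lor (γ s).1 o.1) (h : HasDerivAt γ (γ' s) s)
    (h' : HasDerivAt γ' w s) :
    HasDerivAt (fun s => (γ' s).2 - a (-lor (γ s).1 o.1) * -lor (γ' s).1 o.1)
      (w.2 - a (-lor (γ s).1 o.1) * -lor w.1 o.1
        - b (-lor (γ s).1 o.1) * (-lor (γ' s).1 o.1) ^ 2) s := by
  have h2 := (hG.second _ (h1 s)).comp_hasDerivAt s (hasDerivAt_lor_const h o.1)
    (Filter.Eventually.of_forall h1)
  have := (hasDerivAt_snd_apply h').sub (h2.mul (hasDerivAt_lor_const h' o.1))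
  refine this.congr_deriv ?_
  simp only [Function.comp]
  ring

/-- The function `z - G(cosh d(o, ·))`. -/
def heightDiff (o : HypPlane) (G : ℝ → ℝ) (w : Ambient) : ℝ := w.2 - G (-lor w.1 o.1)

/-- The Hessian of `heightDiff o G` along a surface. -/
def hessian (L : EuclideanSpace ℝ (Fin 2) → Ambient) (x : EuclideanSpace ℝ (Fin 2))
    (o : HypPlane) (a b : ℝ) (ξ ζ : EuclideanSpace ℝ (Fin 2)) : ℝ :=
  (fderiv ℝ (fderiv ℝ L) x ξ ζ).2 - a * -lor (fderiv ℝ (fderiv ℝ L) x ξ ζ).1 o.1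
    - b * (-lor (fderiv ℝ L x ξ).1 o.1 * -lor (fderiv ℝ L x ζ).1 o.1)

theorem hessian_add_smul (o : HypPlane) (a b : ℝ) (r s : ℝ) (ξ ζ : EuclideanSpace ℝ (Fin 2)) :
    hessian L x o a b (r • ξ + s • ζ) (r • ξ + s • ζ) = r ^ 2 * hessian L x o a b ξ ξ
      + r * s * (hessian L x o a b ξ ζ + hessian L x o a b ζ ξ)
      + s ^ 2 * hessian L x o a b ζ ζ := by
  simp only [hessian, map_add, map_smul, add_apply,
    smul_apply, lor, Prod.fst_add, Prod.snd_add, Prod.smul_fst,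
    Prod.smul_snd, Pi.add_apply, Pi.smul_apply, smul_eq_mul]
  ring

theorem fderiv_of_isLocalExtr (hG : HasTwoDerivs G a b) (hL : ContDiffAt ℝ 2 L x)
    (hf : ∀ y, 1 ≤ -lor (L y).1 o.1) (he : IsLocalExtr (fun y => heightDiff o G (L y)) x)
    (ξ : EuclideanSpace ℝ (Fin 2)) :
    (fderiv ℝ L x ξ).2 = a (-lor (L x).1 o.1) * -lor (fderiv ℝ L x ξ).1 o.1 := by
  have h1 := hasDerivAt_heightDiff hG (γ := fun s : ℝ => L (x + s • ξ)) (fun s => hf _)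
    (hasDerivAt_line hL ξ).self_of_nhds
  have hc : ContinuousAt (fun s : ℝ => x + s • ξ) 0 := by fun_prop
  have he' : IsLocalExtr (fun s : ℝ => heightDiff o G (L (x + s • ξ))) 0 := by
    have hx : x + (0 : ℝ) • ξ = x := by simp
    have ht : Filter.Tendsto (fun s : ℝ => x + s • ξ) (nhds 0) (nhds x) := by
      simpa [ContinuousAt] using hc
    rcases he with he | he
    · left
      have := ht.eventually he
      simpa [IsMinFilter, hx] using this
    · right
      have := ht.eventually he
      simpa [IsMaxFilter, hx] using this
  have := he'.hasDerivAt_eq_zero h1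
  simp only [zero_smul, add_zero] at this
  linarith

theorem hessian_nonneg (hG : HasTwoDerivs G a b) (hL : ContDiffAt ℝ 2 L x)
    (hf : ∀ y, 1 ≤ -lor (L y).1 o.1) (he : IsLocalMin (fun y => heightDiff o G (L y)) x)
    (ξ : EuclideanSpace ℝ (Fin 2)) :
    0 ≤ hessian L x o (a (-lor (L x).1 o.1)) (b (-lor (L x).1 o.1)) ξ ξ := by
  have hc : Filter.Tendsto (fun s : ℝ => x + s • ξ) (nhds 0) (nhds x) := by
    have : Continuous (fun s : ℝ => x + s • ξ) := by fun_prop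
    simpa using this.tendsto 0
  have h1 := (hasDerivAt_line hL ξ).mono fun s hs =>
    hasDerivAt_heightDiff hG (γ := fun s : ℝ => L (x + s • ξ)) (fun s => hf _) hs
  have h2 := hasDerivAt_deriv_heightDiff hG (γ := fun s : ℝ => L (x + s • ξ))
    (γ' := fun s : ℝ => fderiv ℝ L (x + s • ξ) ξ) (fun s => hf _)
    (hasDerivAt_line hL ξ).self_of_nhds (hasDerivAt_fderiv_line hL ξ ξ)
  have hmin : IsLocalMin (fun s : ℝ => heightDiff o G (L (x + s • ξ))) 0 := by
    have := hc.eventually he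
    simpa [IsLocalMin, IsMinFilter] using this
  have := second_deriv_nonneg_of_isLocalMin h1 h2 hmin
  simp only [zero_smul, add_zero] at this
  rw [hessian, ← pow_two]
  exact this

theorem hessian_nonpos (hG : HasTwoDerivs G a b) (hL : ContDiffAt ℝ 2 L x)
    (hf : ∀ y, 1 ≤ -lor (L y).1 o.1) (he : IsLocalMax (fun y => heightDiff o G (L y)) x)
    (ξ : EuclideanSpace ℝ (Fin 2)) :
    hessian L x o (a (-lor (L x).1 o.1)) (b (-lor (L x).1 o.1)) ξ ξ ≤ 0 := by
  have hc : Filter.Tendsto (fun s : ℝ => x + s • ξ) (nhds 0) (nhds x) := by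
    have : Continuous (fun s : ℝ => x + s • ξ) := by fun_prop
    simpa using this.tendsto 0
  have h1 := (hasDerivAt_line hL ξ).mono fun s hs =>
    (hasDerivAt_heightDiff hG (γ := fun s : ℝ => L (x + s • ξ)) (fun s => hf _) hs).neg
  have h2 := (hasDerivAt_deriv_heightDiff hG (γ := fun s : ℝ => L (x + s • ξ))
    (γ' := fun s : ℝ => fderiv ℝ L (x + s • ξ) ξ) (fun s => hf _)
    (hasDerivAt_line hL ξ).self_of_nhds (hasDerivAt_fderiv_line hL ξ ξ)).neg
  have hmin : IsLocalMin (fun s : ℝ => -heightDiff o G (L (x + s • ξ))) 0 := by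
    have := hc.eventually he
    simpa [IsLocalMin, IsMinFilter] using this
  have := second_deriv_nonneg_of_isLocalMin h1 h2 hmin
  simp only [zero_smul, add_zero] at this
  rw [hessian, ← pow_two]
  linarith

/-! ### Touching principles for rotational graphs -/

/-- The trace form of a nonnegative quadratic form with respect to a positive one. -/
theorem trace_nonneg {g00 g01 g11 q00 q q11 : ℝ} (h0 : 0 < g00) (hD : 0 < g00 * g11 - g01 ^ 2)
    (hq : ∀ r s : ℝ, 0 ≤ r ^ 2 * q00 + r * s * q + s ^ 2 * q11) :
    0 ≤ g11 * q00 - g01 * q + g00 * q11 := by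
  -- `g₀₀` times the trace form is the value at `(-g₀₁, g₀₀)` plus `(g₀₀ g₁₁ - g₀₁²) q₀₀`.
  have h1 := hq (-g01) g00
  have h2 := hq 1 0
  by_contra hn
  push Not at hn
  nlinarith [mul_nonneg hD.le (show 0 ≤ q00 by linarith), mul_pos h0 (neg_pos.2 hn)]

/-- The operator whose sign decides on which side the rotational graph of `G` bends, compared with
a translating soliton: it is `(1 + |∇G|²)` times the defect of the soliton equation. -/
def defect (a b f : ℝ) : ℝ :=
  2 * (1 + a ^ 2 * (f ^ 2 - 1)) - (b * (f ^ 2 - 1) + a * f * (2 + a ^ 2 * (f ^ 2 - 1)))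

theorem isFrame (hs : IsImmersedSurface I ψ) {η : M → Ambient} (hη : IsUnitNormal I ψ η) {p : M}
    (hp : Set.range I ∈ nhds (extChartAt I p p)) : IsFrame (ψ p).1.1 (frame I ψ p) (η p) where
  position := (ψ p).1.2.1
  tangent i := by
    have h := lor_fderiv_eq_zero ((contDiffAt_localRep hs.contMDiff hp).differentiableAt
      two_ne_zero) (lor_localRep_self p) (EuclideanSpace.single i 1)
    rw [localRep_self] at h
    rw [frame_eq hp]
    exact h
  independent := hs.immersion p
  normal_tangent := hη.tangent p
  normal := hη.normal p
  unit := hη.unit p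

theorem meanCurvature_mul_det {p : M} {n : Ambient}
    (hD : prodForm (frame I ψ p 0) (frame I ψ p 0) * prodForm (frame I ψ p 1) (frame I ψ p 1)
      - prodForm (frame I ψ p 0) (frame I ψ p 1) ^ 2 ≠ 0) :
    2 * meanCurvature I ψ p n * (prodForm (frame I ψ p 0) (frame I ψ p 0) *
      prodForm (frame I ψ p 1) (frame I ψ p 1) - prodForm (frame I ψ p 0) (frame I ψ p 1) ^ 2) =
    prodForm (frame I ψ p 1) (frame I ψ p 1) * prodForm (secondDeriv I ψ p 0 0) n
      - prodForm (frame I ψ p 0) (frame I ψ p 1) *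
        (prodForm (secondDeriv I ψ p 0 1) n + prodForm (secondDeriv I ψ p 1 0) n)
      + prodForm (frame I ψ p 0) (frame I ψ p 0) * prodForm (secondDeriv I ψ p 1 1) n := by
  have hPP := prodForm_comm (frame I ψ p 1) (frame I ψ p 0)
  rw [meanCurvature, Matrix.inv_def, Matrix.adjugate_fin_two, Matrix.det_fin_two,
    Ring.inverse_eq_inv']
  simp only [firstForm, secondForm, Matrix.trace_fin_two, Matrix.smul_mul, Matrix.smul_apply,
    Matrix.mul_apply, Fin.sum_univ_two, Matrix.of_apply, Matrix.cons_val', Matrix.cons_val_zero,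
    Matrix.cons_val_one, Matrix.cons_val_fin_one, smul_eq_mul, hPP]
  rw [← pow_two (prodForm (frame I ψ p 0) (frame I ψ p 1))]
  field_simp
  ring

/-- The trace of the Hessian of `z - G(f)` at a critical point and the mean curvature. -/
theorem trace_hessian_eq (hs : IsImmersedSurface I ψ) {η : M → Ambient}
    (hη : IsUnitNormal I ψ η) {p : M} (hp : Set.range I ∈ nhds (extChartAt I p p)) {a b : ℝ}
    (hcrit : ∀ ξ, (fderiv ℝ (localRep I ψ p) (extChartAt I p p) ξ).2 =
      a * -lor (fderiv ℝ (localRep I ψ p) (extChartAt I p p) ξ).1 o.1) :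
    ∃ g00 g01 g11 l : ℝ, 0 < g00 ∧ 0 < g00 * g11 - g01 ^ 2 ∧ l ≠ 0 ∧
      ∀ Q : EuclideanSpace ℝ (Fin 2) → EuclideanSpace ℝ (Fin 2) → ℝ,
      Q = hessian (localRep I ψ p) (extChartAt I p p) o a b →
      l * prodForm (η p) vertical = 1 ∧
      l ^ 2 * (g11 * Q (EuclideanSpace.single 0 1) (EuclideanSpace.single 0 1)
        - g01 * (Q (EuclideanSpace.single 0 1) (EuclideanSpace.single 1 1)
          + Q (EuclideanSpace.single 1 1) (EuclideanSpace.single 0 1))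
        + g00 * Q (EuclideanSpace.single 1 1) (EuclideanSpace.single 1 1)) =
      (g00 * g11 - g01 ^ 2) * (2 * l ^ 3 * (meanCurvature I ψ p (η p) - prodForm (η p) vertical)
        + defect a b (-lor (ψ p).1.1 o.1)) := by
  have hF := isFrame hs hη hp
  have hL := contDiffAt_localRep hs.contMDiff hp
  have hD := hF.gram_det_pos
  obtain ⟨l, hl1, hl2, hl⟩ := hF.trace_hessian (o := o.1) o.2.1 (a := a) (b := b)
    (fun i => by rw [frame_eq hp]; exact hcrit _) (S := secondDeriv I ψ p)
    (fun i j => by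
      have := lor_fderiv_fderiv hL (lor_localRep_self p) (EuclideanSpace.single i 1)
        (EuclideanSpace.single j 1)
      rw [localRep_self] at this
      rw [secondDeriv_eq hs.contMDiff hp, frame_eq hp, frame_eq hp]
      exact this)
    (Q := fun i j => hessian (localRep I ψ p) (extChartAt I p p) o a b
      (EuclideanSpace.single i 1) (EuclideanSpace.single j 1))
    (fun i j => by
      rw [secondDeriv_eq hs.contMDiff hp, frame_eq hp, frame_eq hp]; rfl)
  have hv : prodForm (η p) vertical = (η p).2 := by simp [prodForm, vertical, lor]
  refine ⟨_, _, _, l, hF.gram_zero_pos, hD, left_ne_zero_of_mul_eq_one hl1, ?_⟩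
  rintro Q rfl
  rw [hv]
  refine ⟨hl1, ?_⟩
  rw [hl, ← meanCurvature_mul_det hD.ne', defect]
  -- Since `l ⟨η, ∂_z⟩ = 1`, the soliton term `2 l³ ⟨η, ∂_z⟩` is `2 l² = 2 (1 + a² (f² - 1))`, and
  -- the sign of `l` does not matter.
  linear_combination (2 * (prodForm (frame I ψ p 0) (frame I ψ p 0) *
      prodForm (frame I ψ p 1) (frame I ψ p 1) - prodForm (frame I ψ p 0) (frame I ψ p 1) ^ 2)) *
      (l ^ 2 * hl1 + hl2)

/-- Touching principle: a translating soliton does not lie locally above the rotational graph of a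
strict supersolution. -/
theorem defect_nonneg_of_isLocalMin {η : M → Ambient} (hs : IsTranslatingSolitonWith I ψ η) {p : M}
    (hp : Set.range I ∈ nhds (extChartAt I p p)) (hG : HasTwoDerivs G a b)
    (he : IsLocalMin (fun y => heightDiff o G (localRep I ψ p y)) (extChartAt I p p)) :
    0 ≤ defect (a (-lor (ψ p).1.1 o.1)) (b (-lor (ψ p).1.1 o.1)) (-lor (ψ p).1.1 o.1) := by
  have hL := contDiffAt_localRep hs.surface.contMDiff hp
  have hc := fderiv_of_isLocalExtr hG hL (one_le_neg_lor_localRep o p) (Or.inl he)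
  have hQ := hessian_nonneg hG hL (one_le_neg_lor_localRep o p) he
  rw [localRep_self] at hc hQ
  obtain ⟨g00, g01, g11, l, h0, hD, -, h⟩ := trace_hessian_eq hs.surface hs.unitNormal hp
    (b := b (-lor (incl (ψ p)).1 o.1)) hc
  have h1 := (h _ rfl).2
  rw [hs.soliton p, sub_self, mul_zero, zero_add] at h1
  have h2 := trace_nonneg h0 hD fun r s =>
    (hQ (r • EuclideanSpace.single 0 1 + s • EuclideanSpace.single 1 1)).trans_eq
      (hessian_add_smul _ _ _ r s _ _)
  exact nonneg_of_mul_nonneg_right (h1 ▸ mul_nonneg (sq_nonneg l) h2) hD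

/-- Touching principle: a translating soliton does not lie locally below the rotational graph of a
strict subsolution. -/
theorem defect_nonpos_of_isLocalMax {η : M → Ambient} (hs : IsTranslatingSolitonWith I ψ η) {p : M}
    (hp : Set.range I ∈ nhds (extChartAt I p p)) (hG : HasTwoDerivs G a b)
    (he : IsLocalMax (fun y => heightDiff o G (localRep I ψ p y)) (extChartAt I p p)) :
    defect (a (-lor (ψ p).1.1 o.1)) (b (-lor (ψ p).1.1 o.1)) (-lor (ψ p).1.1 o.1) ≤ 0 := by
  have hL := contDiffAt_localRep hs.surface.contMDiff hp
  have hc := fderiv_of_isLocalExtr hG hL (one_le_neg_lor_localRep o p) (Or.inr he)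
  have hQ := hessian_nonpos hG hL (one_le_neg_lor_localRep o p) he
  rw [localRep_self] at hc hQ
  obtain ⟨g00, g01, g11, l, h0, hD, -, h⟩ := trace_hessian_eq hs.surface hs.unitNormal hp
    (b := b (-lor (incl (ψ p)).1 o.1)) hc
  have h1 := (h _ rfl).2
  rw [hs.soliton p, sub_self, mul_zero, zero_add] at h1
  set Q := hessian (localRep I ψ p) (extChartAt I p p) o (a (-lor (incl (ψ p)).1 o.1))
    (b (-lor (incl (ψ p)).1 o.1)) with hQdef
  have h2 := trace_nonneg (q00 := -Q (EuclideanSpace.single 0 1) (EuclideanSpace.single 0 1))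
      (q := -(Q (EuclideanSpace.single 0 1) (EuclideanSpace.single 1 1)
          + Q (EuclideanSpace.single 1 1) (EuclideanSpace.single 0 1)))
      (q11 := -Q (EuclideanSpace.single 1 1) (EuclideanSpace.single 1 1)) h0 hD fun r s => by
    have := hQ (r • EuclideanSpace.single 0 1 + s • EuclideanSpace.single 1 1)
    rw [hQdef, hessian_add_smul] at this
    rw [hQdef]
    linarith
  have h3 := mul_nonneg (sq_nonneg l) h2
  by_contra hn
  push Not at hn
  have h4 := mul_pos hD hn
  have h5 : (incl (ψ p)).1 = (ψ p).1.1 := rfl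
  rw [h5] at h1
  linarith

/-- A graph over which `z - G(f)` vanishes, with `G` a solution of the soliton equation, is a
translating soliton. -/
theorem meanCurvature_eq_of_heightDiff_eq (hs : IsImmersedSurface I ψ) {η : M → Ambient}
    (hη : IsUnitNormal I ψ η) {p : M} (hp : Set.range I ∈ nhds (extChartAt I p p))
    (hG : HasTwoDerivs G a b) (h0 : ∀ p, heightDiff o G (incl (ψ p)) = 0)
    (hd : ∀ f, 1 ≤ f → defect (a f) (b f) f = 0) :
    meanCurvature I ψ p (η p) = prodForm (η p) vertical := by
  have hL := contDiffAt_localRep hs.contMDiff hp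
  have hmin : IsLocalMin (fun y => heightDiff o G (localRep I ψ p y)) (extChartAt I p p) :=
    Filter.Eventually.of_forall fun y => ((h0 _).trans (h0 _).symm).le
  have hmax : IsLocalMax (fun y => heightDiff o G (localRep I ψ p y)) (extChartAt I p p) :=
    Filter.Eventually.of_forall fun y => ((h0 _).trans (h0 _).symm).le
  have hc := fderiv_of_isLocalExtr hG hL (one_le_neg_lor_localRep o p) (Or.inl hmin)
  have hQ : ∀ ξ, hessian (localRep I ψ p) (extChartAt I p p) o _ _ ξ ξ = 0 := fun ξ => le_antisymm
    (hessian_nonpos hG hL (one_le_neg_lor_localRep o p) hmax ξ)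
    (hessian_nonneg hG hL (one_le_neg_lor_localRep o p) hmin ξ)
  have hf := one_le_neg_lor_localRep (ψ := ψ) (I := I) o p (extChartAt I p p)
  rw [localRep_self] at hc hQ hf
  obtain ⟨g00, g01, g11, l, hg, hD, hl, h⟩ := trace_hessian_eq hs hη hp
    (b := b (-lor (incl (ψ p)).1 o.1)) hc
  have h1 := (h _ rfl).2
  -- Polarization: the diagonal entries vanish, hence so does the sum of the mixed ones.
  have h2 := hQ ((1 : ℝ) • EuclideanSpace.single 0 1 + (1 : ℝ) • EuclideanSpace.single 1 1)
  rw [hessian_add_smul, hQ, hQ] at h2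
  have h3 := hd _ hf
  rw [hQ, hQ, show (-lor (ψ p).1.1 o.1) = -lor (incl (ψ p)).1 o.1 from rfl, h3] at h1
  have h4 : (g00 * g11 - g01 ^ 2) * (2 * l ^ 3) *
      (meanCurvature I ψ p (η p) - prodForm (η p) vertical) = 0 := by
    linear_combination -h1 - l ^ 2 * g01 * h2
  have h5 : (g00 * g11 - g01 ^ 2) * (2 * l ^ 3) ≠ 0 := by positivity
  exact sub_eq_zero.1 ((mul_eq_zero.1 h4).resolve_left h5)

end Surface

/-! ### Height estimates -/

theorem hasTwoDerivs_zero : HasTwoDerivs (fun _ => 0) (fun _ => 0) (fun _ => 0) :=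
  ⟨fun _ _ => hasDerivWithinAt_const _ _ _, fun _ _ => hasDerivWithinAt_const _ _ _⟩

theorem hasTwoDerivs_two_mul_log :
    HasTwoDerivs (fun c => 2 * Real.log c) (fun c => 2 * c⁻¹) (fun c => 2 * -(c ^ 2)⁻¹) :=
  ⟨fun c hc => ((Real.hasDerivAt_log (by positivity)).const_mul 2).hasDerivWithinAt,
    fun c hc => ((hasDerivAt_inv (by positivity)).const_mul 2).hasDerivWithinAt⟩

theorem hasTwoDerivs_log_add_one :
    HasTwoDerivs (fun c => Real.log (c + 1)) (fun c => (c + 1)⁻¹) (fun c => -((c + 1) ^ 2)⁻¹) :=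
  ⟨fun c hc => ((Real.hasDerivAt_log (by positivity)).comp_add_const c 1).hasDerivWithinAt,
    fun c hc => ((hasDerivAt_inv (by positivity)).comp_add_const c 1).hasDerivWithinAt⟩

theorem defect_zero_pos (f : ℝ) : 0 < defect 0 0 f := by simp [defect]

/-- The defect is `2 (1 - a f) + (f² - 1) (a² (2 - a f) - b)`; the choice `a f = 2` removes the
cubic term and leaves `-2 / f²`. -/
theorem defect_two_mul_log_neg {f : ℝ} (hf : 1 ≤ f) :
    defect (2 * f⁻¹) (2 * -(f ^ 2)⁻¹) f < 0 := by
  have : defect (2 * f⁻¹) (2 * -(f ^ 2)⁻¹) f = -(2 / f ^ 2) := by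
    rw [defect]
    field_simp
    ring
  rw [this, neg_lt_zero]
  positivity

/-- This barrier is matched to the previous one by `cosh 2s + 1 = 2 cosh² s`, used in
`two_mul_log_cosh_le_bowlHeight`. -/
theorem defect_log_add_one_pos {f : ℝ} (hf : 1 ≤ f) :
    0 < defect (f + 1)⁻¹ (-((f + 1) ^ 2)⁻¹) f := by
  have : defect (f + 1)⁻¹ (-((f + 1) ^ 2)⁻¹) f = (2 * f ^ 2 + 3 * f - 1) / (f + 1) ^ 2 := by
    rw [defect]
    field_simp
    ring
  rw [this]
  have : 0 < 2 * f ^ 2 + 3 * f - 1 := by nlinarith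
  positivity

/-! ### Distances and the diameter of the boundary curve -/

theorem cosh_hypDist (p q : HypPlane) : Real.cosh (hypDist p q) = -lor p.1 q.1 :=
  Real.cosh_arcosh (one_le_neg_lor p.2.1 p.2.2 q.2.1 q.2.2)

theorem hypDist_self (p : HypPlane) : hypDist p p = 0 := by
  simp [hypDist, p.2.1, Real.arcosh]

theorem distToSet_slice (p : HypPlane × ℝ) (t : ℝ) : distToSet p (slice t) = |p.2 - t| := by
  have hmem : |p.2 - t| ∈ prodDist p '' slice t :=
    ⟨(p.1, t), rfl, by simp [prodDist, hypDist_self, Real.sqrt_sq_eq_abs]⟩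
  have hle : ∀ d ∈ prodDist p '' slice t, |p.2 - t| ≤ d := by
    rintro _ ⟨q, rfl, rfl⟩
    exact Real.abs_le_sqrt (by linarith [sq_nonneg (hypDist p.1 q.1)])
  exact le_antisymm (csInf_le ⟨_, hle⟩ hmem) (le_csInf ⟨_, hmem⟩ hle)

theorem continuous_hypDist : Continuous fun x : HypPlane × HypPlane => hypDist x.1 x.2 := by
  refine Real.continuousOn_arcosh.comp_continuous ?_ fun x =>
    one_le_neg_lor x.1.2.1 x.1.2.2 x.2.2.1 x.2.2.2
  have h (i : Fin 3) : Continuous fun x : HypPlane × HypPlane => x.1.1 i :=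
    (continuous_apply i).comp (continuous_subtype_val.comp continuous_fst)
  have h' (i : Fin 3) : Continuous fun x : HypPlane × HypPlane => x.2.1 i :=
    (continuous_apply i).comp (continuous_subtype_val.comp continuous_snd)
  exact ((((h 0).mul (h' 0)).add ((h 1).mul (h' 1))).sub ((h 2).mul (h' 2))).neg

/-- Ensures that the supremum defining `diameter` is a true one and not the default value `0` of an
unbounded set. -/
theorem bddAbove_prodDist {S : Set (HypPlane × ℝ)} (hS : IsCompact S) :
    BddAbove {d | ∃ p ∈ S, ∃ q ∈ S, d = prodDist p q} := by
  have hc : Continuous fun x : (HypPlane × ℝ) × (HypPlane × ℝ) => prodDist x.1 x.2 := by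
    have := continuous_hypDist.comp (f := fun x : (HypPlane × ℝ) × (HypPlane × ℝ) =>
      (x.1.1, x.2.1)) (by fun_prop)
    simp only [Function.comp_def] at this
    unfold prodDist
    fun_prop
  refine ((hS.prod hS).bddAbove_image hc.continuousOn).mono ?_
  rintro _ ⟨p, hp, q, hq, rfl⟩
  exact ⟨(p, q), ⟨hp, hq⟩, rfl⟩

theorem neg_lor_le_cosh_diameter {S : Set (HypPlane × ℝ)} (hS : IsCompact S)
    {p q : HypPlane × ℝ} (hp : p ∈ S) (hq : q ∈ S) :
    -lor p.1.1 q.1.1 ≤ Real.cosh (diameter S) := by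
  have h1 : prodDist p q ≤ diameter S := le_csSup (bddAbove_prodDist hS) ⟨p, hp, q, hq, rfl⟩
  have h2 : 0 ≤ hypDist p.1 q.1 :=
    Real.arcosh_nonneg (one_le_neg_lor p.1.2.1 p.1.2.2 q.1.2.1 q.1.2.2)
  have h3 : hypDist p.1 q.1 ≤ prodDist p q :=
    Real.le_sqrt_of_sq_le (by linarith [sq_nonneg (p.2 - q.2)])
  rw [← cosh_hypDist, Real.cosh_le_cosh, abs_of_nonneg h2, abs_of_nonneg (by linarith)]
  linarith

theorem continuous_neg_lor_incl {M : Type*} [TopologicalSpace M] {ψ : M → HypPlane × ℝ}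
    (hψ : Continuous fun p => incl (ψ p)) (o : HypPlane) :
    Continuous fun p => -lor (ψ p).1.1 o.1 := by
  have h (i : Fin 3) : Continuous fun p => (ψ p).1.1 i :=
    (continuous_apply i).comp (continuous_fst.comp hψ)
  simp only [lor]
  have h0 := h 0; have h1 := h 1; have h2 := h 2
  fun_prop

theorem range_mem_nhds_of_notMem_boundary {M : Type*} [TopologicalSpace M]
    [ChartedSpace (EuclideanHalfSpace 2) M] {p : M} (hp : p ∉ (𝓡∂ 2).boundary M) :
    Set.range (𝓡∂ 2) ∈ nhds (extChartAt (𝓡∂ 2) p p) := by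
  rw [← ModelWithCorners.compl_interior, Set.notMem_compl_iff] at hp
  exact mem_interior_iff_mem_nhds.1 hp

/-! ### Upper and lower height bounds for a compact soliton -/

section Compact

variable {M : Type*} [TopologicalSpace M] [CompactSpace M] [Nonempty M]
  [ChartedSpace (EuclideanHalfSpace 2) M] {ψ : M → HypPlane × ℝ} {t₀ : ℝ}

theorem height_le_of_boundary (hs : IsTranslatingSoliton (𝓡∂ 2) ψ)
    (hb : ∀ p ∈ (𝓡∂ 2).boundary M, (ψ p).2 = t₀) (p : M) : (ψ p).2 ≤ t₀ := by
  obtain ⟨η, hη⟩ := hs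
  have hz : Continuous fun p => (ψ p).2 :=
    continuous_snd.comp (f := fun p => incl (ψ p)) hη.surface.contMDiff.continuous
  obtain ⟨q, -, hq⟩ := isCompact_univ.exists_isMaxOn Set.univ_nonempty hz.continuousOn
  replace hq : ∀ p, (ψ p).2 ≤ (ψ q).2 := fun p => hq (Set.mem_univ p)
  by_cases hqb : q ∈ (𝓡∂ 2).boundary M
  · exact (hq p).trans_eq (hb q hqb)
  -- With `G = 0` the defect is `2`, so the height has no interior maximum; the base point `origin`
  -- plays no role.
  · refine absurd (defect_nonpos_of_isLocalMax (o := origin) hη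
      (range_mem_nhds_of_notMem_boundary hqb) hasTwoDerivs_zero
      (Filter.Eventually.of_forall fun y => ?_)) (defect_zero_pos _).not_ge
    beta_reduce
    rw [localRep_self]
    simpa [heightDiff, localRep, incl] using hq _

theorem le_height_of_boundary (hs : IsTranslatingSoliton (𝓡∂ 2) ψ)
    (hb : ∀ p ∈ (𝓡∂ 2).boundary M, (ψ p).2 = t₀) {o : HypPlane} {C : ℝ}
    (hC : ∀ p ∈ (𝓡∂ 2).boundary M, -lor (ψ p).1.1 o.1 ≤ C) (p : M) :
    t₀ - 2 * Real.log C ≤ (ψ p).2 := by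
  obtain ⟨η, hη⟩ := hs
  have hz : Continuous fun p => (ψ p).2 :=
    continuous_snd.comp (f := fun p => incl (ψ p)) hη.surface.contMDiff.continuous
  have hf : ∀ p, 1 ≤ -lor (ψ p).1.1 o.1 := fun p =>
    one_le_neg_lor (ψ p).1.2.1 (ψ p).1.2.2 o.2.1 o.2.2
  have hF : Continuous fun p => heightDiff o (fun c => 2 * Real.log c) (incl (ψ p)) :=
    hz.sub (((continuous_neg_lor_incl hη.surface.contMDiff.continuous o).log
      fun p => (zero_lt_one.trans_le (hf p)).ne').const_mul 2)
  obtain ⟨q, -, hq⟩ := isCompact_univ.exists_isMinOn Set.univ_nonempty hF.continuousOn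
  replace hq : ∀ p, heightDiff o (fun c => 2 * Real.log c) (incl (ψ q)) ≤
      heightDiff o (fun c => 2 * Real.log c) (incl (ψ p)) := fun p => hq (Set.mem_univ p)
  by_cases hqb : q ∈ (𝓡∂ 2).boundary M
  · have h1 := hq p
    simp only [heightDiff, incl] at h1
    have h2 : Real.log (-lor (ψ q).1.1 o.1) ≤ Real.log C :=
      -- With the minimum at a boundary point `q`, the height is `t₀` there and `f ≤ C`; the term `2
      -- log f(p) ≥ 0` is dropped.
      Real.log_le_log (zero_lt_one.trans_le (hf q)) (hC q hqb)
    have h3 := Real.log_nonneg (hf p)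
    rw [hb q hqb] at h1
    linarith
  · refine absurd (defect_nonneg_of_isLocalMin (o := o) hη
      (range_mem_nhds_of_notMem_boundary hqb) hasTwoDerivs_two_mul_log
      (Filter.Eventually.of_forall fun y => ?_)) (defect_two_mul_log_neg (hf q)).not_ge
    beta_reduce
    rw [localRep_self]
    exact hq _

end Compact

/-! ### Lower bound for the height of a bowl -/

theorem exists_rot_circlePoint {s : ℝ} (hs : 0 ≤ s) {x : EuclideanSpace ℝ (Fin 2)}
    (hx : x 0 ^ 2 + x 1 ^ 2 = Real.sinh s ^ 2) : ∃ θ, hypParam x = rot θ (circlePoint s) := by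
  have hS := Real.sinh_nonneg_iff.2 hs
  have h1 : ‖(⟨x 0, x 1⟩ : ℂ)‖ = Real.sinh s := by
    rw [Complex.norm_eq_sqrt_sq_add_sq, hx, Real.sqrt_sq hS]
  have h2 : √(1 + x 0 ^ 2 + x 1 ^ 2) = Real.cosh s := by
    rw [add_assoc, hx, add_comm, ← Real.cosh_sq, Real.sqrt_sq (Real.cosh_pos s).le]
  refine ⟨Complex.arg ⟨x 0, x 1⟩, Subtype.ext ?_⟩
  have hc := Complex.norm_mul_cos_arg (⟨x 0, x 1⟩ : ℂ)
  have hn := Complex.norm_mul_sin_arg (⟨x 0, x 1⟩ : ℂ)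
  rw [h1] at hc hn
  ext i
  fin_cases i
  · simpa [hypParam, rot, circlePoint, mul_comm] using hc.symm
  · simpa [hypParam, rot, circlePoint, mul_comm] using hn.symm
  · simp [hypParam, rot, circlePoint, h2]

theorem neg_lor_origin (p : HypPlane) : -lor p.1 origin.1 = p.1 2 := by
  simp [lor, origin]

/-- Over the disc of radius `s`, the function `u - log (f + 1)` has its maximum on the boundary
circle, where it is constant by symmetry. Comparison with its value at the vertex, where `f = 1`,
gives the bound. -/
theorem log_cosh_le_bowlHeight {u : HypPlane → ℝ} (hu : IsBowlSoliton u) {s : ℝ} (hs : 0 ≤ s) :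
    Real.log (Real.cosh s + 1) - Real.log 2 ≤ bowlHeight u s := by
  obtain ⟨η, hη, -⟩ := hu.soliton
  have hz : Continuous fun x => incl (graphParam u x) := hη.surface.contMDiff.continuous
  have hF : Continuous fun x =>
      heightDiff origin (fun c => Real.log (c + 1)) (incl (graphParam u x)) := by
    refine (continuous_snd.comp hz).sub (((continuous_neg_lor_incl hz origin).add_const 1).log ?_)
    intro x
    have := one_le_neg_lor (graphParam u x).1.2.1 (graphParam u x).1.2.2 origin.2.1 origin.2.2
    linarith
  have hS := Real.sinh_nonneg_iff.2 hs
  obtain ⟨x, hx, hmax⟩ := (isCompact_closedBall (0 : EuclideanSpace ℝ (Fin 2))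
    (Real.sinh s)).exists_isMaxOn ⟨0, by simpa using hS⟩ hF.continuousOn
  have hx' : ‖x‖ ≤ Real.sinh s := by simpa using hx
  rcases hx'.lt_or_eq with hlt | heq
  · refine absurd (defect_nonpos_of_isLocalMax (o := origin) (p := x) hη (by simp)
      hasTwoDerivs_log_add_one ?_) (defect_log_add_one_pos ?_).not_ge
    · have : Metric.closedBall (0 : EuclideanSpace ℝ (Fin 2)) (Real.sinh s) ∈ nhds x :=
        Metric.closedBall_mem_nhds_of_mem (by simpa using hlt)
      exact hmax.isLocalMax this
    · exact one_le_neg_lor (graphParam u x).1.2.1 (graphParam u x).1.2.2 origin.2.1 origin.2.2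
  · have h0 := hmax (show (0 : EuclideanSpace ℝ (Fin 2)) ∈ _ by simpa using hS)
    have hn : x 0 ^ 2 + x 1 ^ 2 = Real.sinh s ^ 2 := by
      rw [← heq, EuclideanSpace.norm_sq_eq]
      simp
    obtain ⟨θ, hθ⟩ := exists_rot_circlePoint hs hn
    have hzero : hypParam 0 = origin := by
      apply Subtype.ext
      ext i
      fin_cases i <;> simp [hypParam, origin]
    simp only [Set.mem_ofPred_eq, heightDiff, incl, graphParam, neg_lor_origin, hθ, hu.rotational,
      hzero] at h0
    have e1 : origin.1 2 = 1 := by simp [origin]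
    have e2 : (rot θ (circlePoint s)).1 2 = Real.cosh s := by simp [rot, circlePoint]
    rw [e1, e2, one_add_one_eq_two] at h0
    rw [bowlHeight, distToSet_slice, sub_zero, abs_sub_comm]
    refine le_trans ?_ (le_abs_self _)
    linarith

theorem two_mul_log_cosh_le_bowlHeight {u : HypPlane → ℝ} (hu : IsBowlSoliton u) {s : ℝ}
    (hs : 0 ≤ s) : 2 * Real.log (Real.cosh s) ≤ bowlHeight u (2 * s) := by
  have h := log_cosh_le_bowlHeight hu (s := 2 * s) (by linarith)
  have e : Real.cosh (2 * s) + 1 = 2 * Real.cosh s ^ 2 := by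
    rw [Real.cosh_two_mul, Real.cosh_sq]; ring
  have hc := Real.cosh_pos s
  rw [e, Real.log_mul two_ne_zero (by positivity), Real.log_pow] at h
  push_cast at h
  linarith

theorem distToSet_le_bowlHeight {u : HypPlane → ℝ} (hu : IsBowlSoliton u)
    {M : Type*} [TopologicalSpace M] [CompactSpace M]
    [ChartedSpace (EuclideanHalfSpace 2) M] {ψ : M → HypPlane × ℝ} {Γ : Set (HypPlane × ℝ)}
    {t₀ : ℝ} (hs : IsTranslatingSoliton (𝓡∂ 2) ψ) (hΓ : IsClosedCurve Γ) (hΓt : Γ ⊆ slice t₀)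
    (hb : ψ '' (𝓡∂ 2).boundary M = Γ) (p : M) :
    distToSet (ψ p) (slice t₀) ≤ bowlHeight u (2 * diameter Γ) := by
  have : Nonempty M := ⟨p⟩
  obtain ⟨γ, hγ, rfl⟩ := hΓ
  have hK : IsCompact (Set.range γ) := isCompact_range hγ
  have hb' : ∀ q ∈ (𝓡∂ 2).boundary M, ψ q ∈ Set.range γ := fun q hq =>
    hb ▸ Set.mem_image_of_mem ψ hq
  have hσ : 0 ≤ diameter (Set.range γ) := by
    refine (Real.sqrt_nonneg _).trans (le_csSup (bddAbove_prodDist hK)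
      ⟨γ 1, ⟨1, rfl⟩, γ 1, ⟨1, rfl⟩, rfl⟩)
  have h1 := height_le_of_boundary hs (fun q hq => hΓt (hb' q hq)) p
  -- The barrier is centred at a point of `Γ`, so that all of `Γ` lies within distance `σ` of its
  -- axis.
  have h2 := le_height_of_boundary hs (fun q hq => hΓt (hb' q hq)) (o := (γ 1).1)
    (fun q hq => neg_lor_le_cosh_diameter hK (hb' q hq) ⟨1, rfl⟩) p
  rw [distToSet_slice, abs_of_nonpos (by linarith)]
  linarith [two_mul_log_cosh_le_bowlHeight hu hσ]

/-! ### The profile equation of the bowl soliton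

The derivative `y` of the height of a rotational graph with respect to `t = cosh s - 1` satisfies
`(t (t + 2) y)' = 2 + t (t + 2) y² (2 - (1 + t) y)`. The singular initial value problem at `t = 0`
is solved by a contraction, after truncation of `y` to `[0, 2 / (1 + t)]`. -/

/-- The truncation of `y` to `[0, 2 / (1 + |t|)]`. -/
def clamp (t y : ℝ) : ℝ := max 0 (min y (2 / (1 + |t|)))

/-- The truncated nonlinearity `y² (2 - (1 + t) y)`. -/
def nonlin (t y : ℝ) : ℝ := clamp t y ^ 2 * (2 - (1 + |t|) * clamp t y)

theorem clamp_nonneg (t y : ℝ) : 0 ≤ clamp t y := le_max_left _ _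

theorem clamp_mul_le (t y : ℝ) : (1 + |t|) * clamp t y ≤ 2 := by
  have h : 0 < 1 + |t| := by positivity
  rw [mul_comm, ← le_div_iff₀ h]
  exact max_le (by positivity) (min_le_right _ _)

theorem clamp_le_two (t y : ℝ) : clamp t y ≤ 2 := by
  nlinarith [clamp_mul_le t y, clamp_nonneg t y, abs_nonneg t]

theorem abs_clamp_sub_le (t y z : ℝ) : |clamp t y - clamp t z| ≤ |y - z| := by
  refine (abs_max_sub_max_le_max _ _ _ _).trans ?_
  rw [sub_self, abs_zero]
  refine max_le (abs_nonneg _) ((abs_min_sub_min_le_max _ _ _ _).trans ?_)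
  rw [sub_self, abs_zero]
  exact max_le le_rfl (abs_nonneg _)

theorem nonlin_nonneg (t y : ℝ) : 0 ≤ nonlin t y :=
  mul_nonneg (sq_nonneg _) (by linarith [clamp_mul_le t y])

theorem nonlin_le (t y : ℝ) : nonlin t y ≤ 8 := by
  have h1 := clamp_nonneg t y
  have h2 := clamp_le_two t y
  have h3 : 0 ≤ (1 + |t|) * clamp t y := by positivity
  have h4 : clamp t y ^ 2 ≤ 4 := by nlinarith
  rw [nonlin]
  nlinarith [sq_nonneg (clamp t y), clamp_mul_le t y]

theorem abs_nonlin_sub_le (t y z : ℝ) : |nonlin t y - nonlin t z| ≤ 12 * |y - z| := by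
  have e : nonlin t y - nonlin t z = (clamp t y - clamp t z) *
      (2 * (clamp t y + clamp t z) - ((1 + |t|) * clamp t y * clamp t y
        + (1 + |t|) * clamp t y * clamp t z + (1 + |t|) * clamp t z * clamp t z)) := by
    simp only [nonlin]; ring
  have a1 := clamp_nonneg t y
  have a2 := clamp_nonneg t z
  have b1 := clamp_le_two t y
  have b2 := clamp_le_two t z
  have c1 := clamp_mul_le t y
  have c2 := clamp_mul_le t z
  have d1 : 0 ≤ (1 + |t|) * clamp t y := by positivity
  have d2 : 0 ≤ (1 + |t|) * clamp t z := by positivity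
  have m1 := mul_le_mul c1 b1 a1 zero_le_two
  have m2 := mul_le_mul c1 b2 a2 zero_le_two
  have m3 := mul_le_mul c2 b2 a2 zero_le_two
  have n1 := mul_nonneg d1 a1
  have n2 := mul_nonneg d1 a2
  have n3 := mul_nonneg d2 a2
  rw [e, abs_mul, mul_comm]
  -- With the clamped values at most `2` and their products with `1 + |t|` at most `2`, the second
  -- factor lies between `-12` and `8`.
  refine mul_le_mul (abs_le.2 ⟨by linarith, by linarith⟩) (abs_clamp_sub_le t y z)
    (abs_nonneg _) (by norm_num)

theorem continuous_nonlin : Continuous fun x : ℝ × ℝ => nonlin x.1 x.2 := by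
  have : Continuous fun x : ℝ × ℝ => clamp x.1 x.2 := by
    unfold clamp
    refine continuous_const.max (continuous_snd.min (continuous_const.div (by fun_prop) ?_))
    intro x
    positivity
  unfold nonlin
  fun_prop

/-- The averaging kernel of the profile equation. -/
def kernel (t r : ℝ) : ℝ := r * (|t| * r + 2) / (|t| + 2)

theorem continuous_kernel : Continuous fun x : ℝ × ℝ => kernel x.1 x.2 := by
  unfold kernel
  exact Continuous.div (by fun_prop) (by fun_prop) fun x => by positivity

theorem kernel_nonneg (t : ℝ) {r : ℝ} (h : 0 ≤ r) : 0 ≤ kernel t r := by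
  unfold kernel; positivity

theorem kernel_le_one (t : ℝ) {r : ℝ} (h : 0 ≤ r) (h1 : r ≤ 1) : kernel t r ≤ 1 := by
  rw [kernel, div_le_one (by positivity)]
  have := mul_le_mul_of_nonneg_left h1 (abs_nonneg t)
  nlinarith [mul_nonneg (abs_nonneg t) h]

/-- The mean value over `[0, t]` of `κ` with respect to the density `s (s + 2)`, up to a factor. -/
def average (κ : ℝ → ℝ) (t : ℝ) : ℝ := ∫ r in (0 : ℝ)..1, kernel t r * κ (|t| * r)

theorem continuous_average {κ : ℝ → ℝ} (hκ : Continuous κ) : Continuous (average κ) := by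
  refine intervalIntegral.continuous_parametric_intervalIntegral_of_continuous' ?_ 0 1
  exact continuous_kernel.mul (hκ.comp (by fun_prop))

theorem average_nonneg {κ : ℝ → ℝ} (hκ : ∀ t, 0 ≤ κ t) (t : ℝ) : 0 ≤ average κ t :=
  intervalIntegral.integral_nonneg zero_le_one fun _ hr => mul_nonneg (kernel_nonneg t hr.1) (hκ _)

theorem intervalIntegrable_kernel_mul {κ : ℝ → ℝ} (hκ : Continuous κ) (t : ℝ) :
    IntervalIntegrable (fun r => kernel t r * κ (|t| * r)) MeasureTheory.volume 0 1 := by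
  have : Continuous fun r => kernel t r * κ (|t| * r) :=
    (continuous_kernel.comp (f := fun r : ℝ => (t, r)) (by fun_prop)).mul (hκ.comp (by fun_prop))
  exact this.intervalIntegrable _ _

theorem abs_average_le {κ : ℝ → ℝ} {C : ℝ} (hC : ∀ t, |κ t| ≤ C) (t : ℝ) :
    |average κ t| ≤ C := by
  have := intervalIntegral.norm_integral_le_of_norm_le_const (a := 0) (b := 1) (C := C)
    (f := fun r => kernel t r * κ (|t| * r)) fun r hr => by
      rw [Set.uIoc_of_le zero_le_one] at hr
      rw [Real.norm_eq_abs, abs_mul, abs_of_nonneg (kernel_nonneg t hr.1.le)]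
      exact (mul_le_of_le_one_left (abs_nonneg _) (kernel_le_one t hr.1.le hr.2)).trans (hC _)
  simpa [average] using this

/-- Since `|t| ∫₀¹ 12 e^{24|t|r} dr = (e^{24|t|} - 1) / 2`, an exponential weight at twice the
Lipschitz constant `12` yields the contraction factor `1/2`. -/
theorem abs_mul_average_sub_le {κ μ : ℝ → ℝ} (hκ : Continuous κ) (hμ : Continuous μ) {D : ℝ}
    (hD : 0 ≤ D) (h : ∀ t, |κ t - μ t| ≤ 12 * (Real.exp (24 * |t|) * D)) (t : ℝ) :
    |t| * |average κ t - average μ t| ≤ Real.exp (24 * |t|) * (D / 2) := by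
  rw [average, average, ← intervalIntegral.integral_sub (intervalIntegrable_kernel_mul hκ t)
    (intervalIntegrable_kernel_mul hμ t)]
  have hexp : ∀ r : ℝ, HasDerivAt (fun r => Real.exp (24 * |t| * r) * (D / 2))
      (|t| * (12 * (Real.exp (24 * |t| * r) * D))) r := by
    intro r
    have := (((hasDerivAt_id r).const_mul (24 * |t|)).exp).mul_const (D / 2)
    refine this.congr_deriv ?_
    simp only [id]
    ring
  have hcont : Continuous fun r : ℝ => |t| * (12 * (Real.exp (24 * |t| * r) * D)) := by fun_prop
  have hint := intervalIntegral.integral_eq_sub_of_hasDerivAt (a := 0) (b := 1)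
    (fun r _ => hexp r) (hcont.intervalIntegrable _ _)
  have hle := intervalIntegral.norm_integral_le_of_norm_le (a := 0) (b := 1)
    (f := fun r => |t| * (kernel t r * κ (|t| * r) - kernel t r * μ (|t| * r)))
    (g := fun r => |t| * (12 * (Real.exp (24 * |t| * r) * D))) (μ := MeasureTheory.volume) zero_le_one
    (MeasureTheory.ae_of_all _ fun r hr => by
      rw [← mul_sub, Real.norm_eq_abs, abs_mul, abs_abs, abs_mul,
        abs_of_nonneg (kernel_nonneg t hr.1.le)]
      refine mul_le_mul_of_nonneg_left ?_ (abs_nonneg t)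
      refine (mul_le_of_le_one_left (abs_nonneg _) (kernel_le_one t hr.1.le hr.2)).trans ?_
      have := h (|t| * r)
      rwa [abs_mul, abs_abs, abs_of_nonneg hr.1.le, ← mul_assoc 24] at this)
    (hcont.intervalIntegrable _ _)
  rw [intervalIntegral.integral_const_mul, Real.norm_eq_abs, abs_mul, abs_abs, hint] at hle
  refine hle.trans ?_
  simp only [mul_one, mul_zero, Real.exp_zero]
  linarith

/-- The substitution `s = t r`. Integrating over the fixed interval `[0, 1]` keeps `average`
continuous at the singular point `t = 0`. -/
theorem sq_mul_average (κ : ℝ → ℝ) {t : ℝ} (ht : 0 ≤ t) :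
    t ^ 2 * (t + 2) * average κ t = ∫ s in (0 : ℝ)..t, s * (s + 2) * κ s := by
  have h := intervalIntegral.mul_integral_comp_mul_left (a := 0) (b := 1)
    (f := fun s => s * (s + 2) * κ s) (c := t)
  rw [mul_zero, mul_one] at h
  rw [← h, average, abs_of_nonneg ht, ← intervalIntegral.integral_const_mul,
    ← intervalIntegral.integral_const_mul]
  refine intervalIntegral.integral_congr fun r _ => ?_
  simp only [kernel, abs_of_nonneg ht]
  field_simp

theorem hasDerivWithinAt_mul_average {κ : ℝ → ℝ} (hκ : Continuous κ) {t : ℝ} (ht : 0 ≤ t) :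
    HasDerivWithinAt (fun t => t * average κ t)
      (κ t - 2 * (1 + t) * average κ t / (t + 2)) (Set.Ici 0) t := by
  rcases ht.eq_or_lt with rfl | hpos
  · have h0 : average κ 0 = κ 0 / 2 := by
      simp [average, kernel]
      ring
    -- At the singular point the difference quotient is `average κ` itself, so continuity is enough.
    have : HasDerivAt (fun t => t * average κ t) (average κ 0) 0 := by
      rw [hasDerivAt_iff_tendsto_slope_zero]
      have := (continuous_average hκ).tendsto 0
      refine (this.mono_left nhdsWithin_le_nhds).congr' ?_
      filter_upwards [self_mem_nhdsWithin] with s hs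
      have hs' : s ≠ 0 := hs
      simp [hs']
    refine this.hasDerivWithinAt.congr_deriv ?_
    rw [h0]
    ring
  · have hJ : HasDerivAt (fun t => ∫ s in (0 : ℝ)..t, s * (s + 2) * κ s) (t * (t + 2) * κ t) t := by
      have hc : Continuous fun s : ℝ => s * (s + 2) * κ s := by fun_prop
      exact hc.deriv_integral _ 0 t ▸ (hc.integral_hasStrictDerivAt 0 t).hasDerivAt
    have hden : HasDerivAt (fun t : ℝ => t * (t + 2)) (2 * t + 2) t := by
      refine ((hasDerivAt_id t).mul ((hasDerivAt_id t).add_const 2)).congr_deriv ?_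
      simp only [id]
      ring
    have hne : t * (t + 2) ≠ 0 := by positivity
    have hq := hJ.div hden hne
    have hd : HasDerivAt (fun t => t * average κ t)
        (κ t - 2 * (1 + t) * average κ t / (t + 2)) t := by
      refine (hq.congr_of_eventuallyEq ?_).congr_deriv ?_
      · filter_upwards [lt_mem_nhds hpos] with s hs
        simp only [Pi.div_apply]
        rw [← sq_mul_average κ hs.le]
        field_simp
      · rw [← sq_mul_average κ ht]
        field_simp
        ring
    exact hd.hasDerivWithinAt

/-- The function whose average solves the truncated equation, in terms of the weighted unknown. -/
def weighted (f : ℝ → ℝ) (t : ℝ) : ℝ := nonlin t (Real.exp (24 * |t|) * f t)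

theorem continuous_weighted {f : ℝ → ℝ} (hf : Continuous f) : Continuous (weighted f) :=
  continuous_nonlin.comp (f := fun t => (t, Real.exp (24 * |t|) * f t)) (by fun_prop)

theorem abs_weighted_le (f : ℝ → ℝ) (t : ℝ) : |weighted f t| ≤ 8 := by
  rw [weighted, abs_of_nonneg (nonlin_nonneg _ _)]
  exact nonlin_le _ _

/-- The integral operator of the truncated equation, conjugated with a weight. -/
def profileOp (f : ℝ → ℝ) (t : ℝ) : ℝ :=
  Real.exp (-(24 * |t|)) * (2 / (|t| + 2) + |t| * average (weighted f) t)

theorem continuous_profileOp {f : ℝ → ℝ} (hf : Continuous f) : Continuous (profileOp f) := by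
  have h1 := continuous_average (continuous_weighted hf)
  have h2 : Continuous fun t : ℝ => 2 / (|t| + 2) :=
    continuous_const.div (by fun_prop) fun t => by positivity
  unfold profileOp
  fun_prop

theorem abs_profileOp_le (f : ℝ → ℝ) (t : ℝ) : |profileOp f t| ≤ 2 := by
  have h1 := abs_average_le (abs_weighted_le f) t
  have h2 : |2 / (|t| + 2)| ≤ 1 := by
    rw [abs_of_nonneg (by positivity), div_le_one (by positivity)]
    linarith [abs_nonneg t]
  have h3 := Real.add_one_le_exp (24 * |t|)
  rw [profileOp, abs_mul, abs_of_pos (Real.exp_pos _), Real.exp_neg, inv_mul_le_iff₀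
    (Real.exp_pos _)]
  refine (abs_add_le _ _).trans ?_
  rw [abs_mul, abs_abs]
  nlinarith [mul_le_mul_of_nonneg_left h1 (abs_nonneg t), abs_nonneg t]

-- Banach's fixed point theorem on bounded continuous functions on `ℝ`. The absolute values of `t`
-- extend the problem evenly beyond the half-line, and the weight allows a solution for all times at
-- once.
open BoundedContinuousFunction in
theorem exists_fixedPoint_profileOp : ∃ f : ℝ → ℝ, Continuous f ∧ profileOp f = f := by
  let T : (ℝ →ᵇ ℝ) → (ℝ →ᵇ ℝ) := fun f =>
    BoundedContinuousFunction.ofNormedAddCommGroup (profileOp f)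
      (continuous_profileOp f.continuous) 2 (abs_profileOp_le f)
  have hT : ContractingWith (1 / 2) T := by
    refine ⟨by norm_num, LipschitzWith.of_dist_le_mul fun f g => ?_⟩
    refine (dist_le (by positivity)).2 fun t => ?_
    have hD := dist_nonneg (x := f) (y := g)
    have key := abs_mul_average_sub_le (continuous_weighted f.continuous)
      (continuous_weighted g.continuous) hD (fun s => by
        refine (abs_nonlin_sub_le _ _ _).trans ?_
        rw [← mul_sub, abs_mul, abs_of_pos (Real.exp_pos _)]
        have := dist_coe_le_dist (f := f) (g := g) s
        rw [Real.dist_eq] at this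
        gcongr) t
    have e : T f t - T g t = Real.exp (-(24 * |t|)) *
        (|t| * (average (weighted f) t - average (weighted g) t)) := by
      change profileOp f t - profileOp g t = _
      simp only [profileOp]
      ring
    rw [Real.dist_eq, e, abs_mul, abs_mul, abs_abs, abs_of_pos (Real.exp_pos _), Real.exp_neg,
      inv_mul_le_iff₀ (Real.exp_pos _)]
    refine key.trans_eq ?_
    push_cast
    ring
  obtain ⟨f, hf⟩ : ∃ f, T f = f := ⟨_, hT.fixedPoint_isFixedPt⟩
  refine ⟨f, f.continuous, ?_⟩
  exact congrArg (fun f : ℝ →ᵇ ℝ => (f : ℝ → ℝ)) hf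

/-- The profile equation, in the variable `c = cosh s`, has a solution on `[1, ∞)`. -/
theorem exists_profile : ∃ h h' : ℝ → ℝ, Continuous h ∧
    (∀ c, 1 ≤ c → HasDerivWithinAt h (h' c) (Set.Ici 1) c) ∧ ContinuousOn h' (Set.Ici 1) ∧
    ∀ c, 1 ≤ c → defect (h c) (h' c) c = 0 := by
  obtain ⟨f, hf, hfix⟩ := exists_fixedPoint_profileOp
  set κ := weighted f with hκdef
  have hκ : Continuous κ := continuous_weighted hf
  have hR := continuous_average hκ
  set y : ℝ → ℝ := fun t => Real.exp (24 * |t|) * f t with hy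
  have hyc : Continuous y := by fun_prop
  have hκy : ∀ t, κ t = nonlin t (y t) := fun t => rfl
  have hyeq : ∀ t, 0 ≤ t → y t = 2 / (t + 2) + t * average κ t := by
    intro t ht
    have := congrFun hfix t
    rw [profileOp, abs_of_nonneg ht] at this
    simp only [hy, abs_of_nonneg ht]
    rw [← this, ← mul_assoc, ← Real.exp_add, add_neg_cancel, Real.exp_zero, one_mul]
  set y' : ℝ → ℝ := fun t => -2 / (t + 2) ^ 2 + (κ t - 2 * (1 + t) * average κ t / (t + 2))
    with hy'
  have hderiv : ∀ t, 0 ≤ t → HasDerivWithinAt y (y' t) (Set.Ici 0) t := by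
    intro t ht
    have h1 : HasDerivAt (fun t : ℝ => 2 / (t + 2)) (-2 / (t + 2) ^ 2) t := by
      have := ((hasDerivAt_id t).add_const 2).fun_inv (by simp only [id]; positivity)
      refine (this.const_mul 2).congr_deriv ?_
      simp only [id]
      ring
    refine (h1.hasDerivWithinAt.add (hasDerivWithinAt_mul_average hκ ht)).congr
      (fun s hs => hyeq s hs) (hyeq t ht)
  have hode : ∀ t, 0 ≤ t → t * (t + 2) * y' t =
      2 - 2 * (1 + t) * y t + t * (t + 2) * κ t := by
    intro t ht
    rw [hyeq t ht]
    simp only [hy']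
    field_simp
    ring
  have hpos : ∀ t, 0 ≤ t → 0 ≤ y t := by
    intro t ht
    have := average_nonneg (κ := κ) (fun s => nonlin_nonneg _ _) t
    rw [hyeq t ht]
    positivity
  have hy0 : y 0 = 1 := by rw [hyeq 0 le_rfl]; norm_num
  -- The curve `2 / (1 + t)` is an upper barrier. Where `y` meets it the nonlinearity vanishes, and
  -- after multiplication by `t (t + 2)` the slopes are `-2` for `y` and `-2 + 2 / (1 + t)²` for the
  -- barrier, so `y` cannot cross.
  have hle : ∀ t, 0 ≤ t → y t ≤ 2 / (1 + t) := by
    intro t ht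
    have hB : ∀ s : ℝ, 0 ≤ s → HasDerivAt (fun s : ℝ => 2 / (1 + s)) (-2 / (1 + s) ^ 2) s := by
      intro s hs
      have := ((hasDerivAt_id s).const_add 1).fun_inv (by simp only [id]; positivity)
      refine (this.const_mul 2).congr_deriv ?_
      simp only [id]
      ring
    refine image_le_of_deriv_right_lt_deriv_boundary' (a := 0) (b := t) (f' := y')
      (B' := fun s => -2 / (1 + s) ^ 2) hyc.continuousOn
      (fun s hs => (hderiv s hs.1).mono (Set.Ici_subset_Ici.2 hs.1)) (by rw [hy0]; norm_num)
      (fun s hs => (hB s hs.1).continuousAt.continuousWithinAt)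
      (fun s hs => (hB s hs.1).hasDerivWithinAt) ?_ ⟨ht, le_rfl⟩
    intro s hs heq
    have hs0 : 0 < s := by
      rcases hs.1.eq_or_lt with h | h
      · rw [← h, hy0] at heq; norm_num at heq
      · exact h
    have hcl : clamp s (y s) = 2 / (1 + s) := by
      rw [clamp, heq, abs_of_pos hs0, min_self, max_eq_right (by positivity)]
    have hk : κ s = 0 := by
      rw [hκy, nonlin, hcl, abs_of_pos hs0]
      field_simp
      ring
    have h1 := hode s hs0.le
    rw [hk, heq] at h1
    have h2 : s * (s + 2) * y' s = -2 := by
      rw [h1]; field_simp; ring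
    have h3 : s * (s + 2) * (-2 / (1 + s) ^ 2) = -2 + 2 / (1 + s) ^ 2 := by
      field_simp; ring
    have h4 : 0 < 2 / (1 + s) ^ 2 := by positivity
    have h5 : 0 < s * (s + 2) := by positivity
    exact lt_of_mul_lt_mul_left (by rw [h2, h3]; linarith) h5.le
  -- Since `0 ≤ y ≤ 2 / (1 + t)`, the truncation is inactive and `y` solves the original equation.
  have hκ' : ∀ t, 0 ≤ t → κ t = y t ^ 2 * (2 - (1 + t) * y t) := by
    intro t ht
    have : clamp t (y t) = y t := by
      rw [clamp, abs_of_nonneg ht, min_eq_left (hle t ht), max_eq_right (hpos t ht)]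
    rw [hκy, nonlin, this, abs_of_nonneg ht]
  refine ⟨fun c => y (c - 1), fun c => y' (c - 1), by fun_prop, ?_, ?_, ?_⟩
  · intro c hc
    have h1 : HasDerivWithinAt (fun c : ℝ => c - 1) 1 (Set.Ici 1) c :=
      ((hasDerivAt_id c).sub_const 1).hasDerivWithinAt
    have := (hderiv (c - 1) (by linarith)).comp c h1 fun s (hs : 1 ≤ s) =>
      show (0 : ℝ) ≤ s - 1 by linarith
    exact this.congr_deriv (mul_one _)
  · have : ContinuousOn y' (Set.Ici 0) := by
      have h2 : ∀ t ∈ Set.Ici (0 : ℝ), t + 2 ≠ 0 := fun t (ht : 0 ≤ t) => by positivity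
      have h3 : ∀ t ∈ Set.Ici (0 : ℝ), (t + 2) ^ 2 ≠ 0 := fun t (ht : 0 ≤ t) => by positivity
      refine ContinuousOn.add (ContinuousOn.div (by fun_prop) (by fun_prop) h3)
        (ContinuousOn.sub hκ.continuousOn (ContinuousOn.div (by fun_prop) (by fun_prop) h2))
    exact this.comp (by fun_prop) fun s (hs : 1 ≤ s) => show (0 : ℝ) ≤ s - 1 by linarith
  · intro c hc
    have h1 := hode (c - 1) (by linarith)
    rw [hκ' (c - 1) (by linarith)] at h1
    rw [defect]
    linear_combination -h1

/-! ### Existence of bowl solitons -/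

theorem HasTwoDerivs.contDiffOn {G a b : ℝ → ℝ} (hG : HasTwoDerivs G a b)
    (hb : ContinuousOn b (Set.Ici 1)) : ContDiffOn ℝ 2 G (Set.Ici 1) := by
  have hu : UniqueDiffOn ℝ (Set.Ici (1 : ℝ)) := uniqueDiffOn_Ici 1
  have step : ∀ {F F' : ℝ → ℝ} {n : ℕ}, (∀ c, 1 ≤ c → HasDerivWithinAt F (F' c) (Set.Ici 1) c) →
      ContDiffOn ℝ n F' (Set.Ici 1) → ContDiffOn ℝ (n + 1) F (Set.Ici 1) := by
    intro F F' n hF hF'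
    refine (contDiffOn_succ_iff_derivWithin hu).2 ⟨fun c hc => (hF c hc).differentiableWithinAt,
      by simp, hF'.congr fun c hc => (hF c hc).derivWithin (hu c hc)⟩
  have h0 : ContDiffOn ℝ ((0 : ℕ) : WithTop ℕ∞) b (Set.Ici 1) := by
    simpa using (contDiffOn_zero (𝕜 := ℝ)).2 hb
  have h1 : ContDiffOn ℝ ((1 : ℕ) : WithTop ℕ∞) a (Set.Ici 1) := by
    simpa using step hG.second h0
  have h2 := step hG.first h1
  exact h2

section Graph

variable {G a b : ℝ → ℝ}

/-- The rotational function `G(cosh d(o, ·))`. -/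
def rotational (G : ℝ → ℝ) (p : HypPlane) : ℝ := G (p.1 2)

theorem contDiff_hypParam_two :
    ContDiff ℝ 2 fun x : EuclideanSpace ℝ (Fin 2) => √(1 + x 0 ^ 2 + x 1 ^ 2) := by
  refine ContDiff.sqrt ?_ fun x => by positivity
  fun_prop

/-- The variable `cosh s` is a smooth function on `ℍ²`, with value `1` at the vertex, so one-sided
`C²` regularity of `G` at `1` already makes the graph `C²` there. -/
theorem contDiff_graphParam (hG : HasTwoDerivs G a b) (hb : ContinuousOn b (Set.Ici 1)) :
    ContDiff ℝ 2 fun x => incl (graphParam (rotational G) x) := by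
  have h2 := contDiff_hypParam_two
  refine ContDiff.prodMk (contDiff_pi.2 fun i => ?_) ?_
  · fin_cases i
    · simp [graphParam, hypParam]; fun_prop
    · simp [graphParam, hypParam]; fun_prop
    · simpa [graphParam, hypParam] using h2
  · have := (hG.contDiffOn hb).comp_contDiff h2 fun x => Real.one_le_sqrt.2 (by
      linarith [sq_nonneg (x 0), sq_nonneg (x 1)])
    simpa [graphParam, hypParam, rotational, Function.comp_def] using this

/-- The first two coordinates of the parametrization are those of `x`; this gives the immersion
property. -/
theorem fst_fderiv_graphParam (u : HypPlane → ℝ) {x : EuclideanSpace ℝ (Fin 2)}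
    (h : DifferentiableAt ℝ (fun x => incl (graphParam u x)) x) (ξ : EuclideanSpace ℝ (Fin 2)) :
    (fderiv ℝ (fun x => incl (graphParam u x)) x ξ).1 0 = ξ 0 ∧
      (fderiv ℝ (fun x => incl (graphParam u x)) x ξ).1 1 = ξ 1 := by
  have hl : HasDerivAt (fun s : ℝ => x + s • ξ) ξ 0 := by
    simpa using ((hasDerivAt_id (0 : ℝ)).smul_const ξ).const_add x
  have hd : HasFDerivAt (fun x => incl (graphParam u x))
      (fderiv ℝ (fun x => incl (graphParam u x)) x) (x + (0 : ℝ) • ξ) := by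
    simpa using h.hasFDerivAt
  have h1 := hd.comp_hasDerivAt (0 : ℝ) hl
  have e (i : Fin 2) : HasDerivAt (fun s : ℝ => x i + s * ξ i) (ξ i) 0 := by
    simpa using ((hasDerivAt_id (0 : ℝ)).mul_const (ξ i)).const_add (x i)
  constructor
  · refine (hasDerivAt_fst_apply h1 0).unique ((e 0).congr_of_eventuallyEq ?_)
    exact Filter.Eventually.of_forall fun s => by simp [incl, graphParam, hypParam]
  · refine (hasDerivAt_fst_apply h1 1).unique ((e 1).congr_of_eventuallyEq ?_)
    exact Filter.Eventually.of_forall fun s => by simp [incl, graphParam, hypParam]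

theorem localRep_graphParam (u : HypPlane → ℝ) (p : EuclideanSpace ℝ (Fin 2)) :
    localRep (𝓡 2) (graphParam u) p = fun x => incl (graphParam u x) := by
  funext x
  simp only [localRep, extChartAt_model_space_eq_id, PartialEquiv.refl_symm, PartialEquiv.refl_coe,
    id]

theorem isImmersedSurface_graphParam (hG : HasTwoDerivs G a b) (hb : ContinuousOn b (Set.Ici 1)) :
    IsImmersedSurface (𝓡 2) (graphParam (rotational G)) where
  contMDiff := (contDiff_graphParam hG hb).contMDiff
  immersion p := by
    have hd : DifferentiableAt ℝ (fun x => incl (graphParam (rotational G) x)) p :=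
      (contDiff_graphParam hG hb).differentiable two_ne_zero p
    rw [Fintype.linearIndependent_iff]
    intro g hg
    rw [Fin.sum_univ_two, frame_eq (by simp), frame_eq (by simp), localRep_graphParam] at hg
    simp only [← map_smul, ← map_add] at hg
    have h := fst_fderiv_graphParam (rotational G) hd
      (g 0 • EuclideanSpace.single 0 1 + g 1 • EuclideanSpace.single 1 1)
    have hg' : fderiv ℝ (fun x => incl (graphParam (rotational G) x)) p
      (g 0 • EuclideanSpace.single 0 1 + g 1 • EuclideanSpace.single 1 1) = 0 := hg
    rw [hg'] at h
    intro i
    fin_cases i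
    · simpa using h.1.symm
    · simpa using h.2.symm

/-- The gradient `∂_z - G'(f) ∇f` of `z - G(f)` along the graph of `G(f)`. -/
def graphGradient (a : ℝ → ℝ) (x : EuclideanSpace ℝ (Fin 2)) : Ambient :=
  ((-a ((hypParam x).1 2)) • ((hypParam x).1 2 • (hypParam x).1 - origin.1), 1)

/-- The upwards unit normal of the graph of `G(f)`. -/
def graphNormal (a : ℝ → ℝ) (x : EuclideanSpace ℝ (Fin 2)) : Ambient :=
  (√(prodForm (graphGradient a x) (graphGradient a x)))⁻¹ • graphGradient a x

theorem lor_graphGradient (a : ℝ → ℝ) (x : EuclideanSpace ℝ (Fin 2)) :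
    lor (graphGradient a x).1 (hypParam x).1 = 0 := by
  have h := (hypParam x).2.1
  simp only [graphGradient, lor, origin, Pi.smul_apply, Pi.sub_apply, smul_eq_mul,
    Matrix.cons_val] at h ⊢
  linear_combination (-a ((hypParam x).1 2) * (hypParam x).1 2) * h

theorem prodForm_graphGradient_pos (a : ℝ → ℝ) (x : EuclideanSpace ℝ (Fin 2)) :
    0 < prodForm (graphGradient a x) (graphGradient a x) := by
  refine lt_of_le_of_ne (prodForm_self_nonneg (hypParam x).2.1 (lor_graphGradient a x)) fun h => ?_
  have := eq_zero_of_prodForm_self (hypParam x).2.1 (lor_graphGradient a x) h.symm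
  simpa [graphGradient] using congrArg Prod.snd this

theorem continuous_graphNormal {a : ℝ → ℝ} (ha : Continuous a) : Continuous (graphNormal a) := by
  have h2 := contDiff_hypParam_two.continuous
  have hX : Continuous fun x => (hypParam x).1 := by
    refine continuous_pi fun i => ?_
    fin_cases i
    · simp [hypParam]; fun_prop
    · simp [hypParam]; fun_prop
    · simpa [hypParam] using h2
  have hX2 : Continuous fun x => (hypParam x).1 2 := (continuous_apply 2).comp hX
  have hg : Continuous (graphGradient a) := by
    unfold graphGradient
    fun_prop
  have hp : Continuous fun x => prodForm (graphGradient a x) (graphGradient a x) := by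
    have h (i : Fin 3) : Continuous fun x => (graphGradient a x).1 i :=
      (continuous_apply i).comp (continuous_fst.comp hg)
    have h' : Continuous fun x => (graphGradient a x).2 := continuous_snd.comp hg
    exact ((((h 0).mul (h 0)).add ((h 1).mul (h 1))).sub ((h 2).mul (h 2))).add (h'.mul h')
  exact (hp.sqrt.inv₀ fun x => (Real.sqrt_pos.2 (prodForm_graphGradient_pos a x)).ne').smul hg

theorem heightDiff_graphParam (x : EuclideanSpace ℝ (Fin 2)) :
    heightDiff origin G (incl (graphParam (rotational G) x)) = 0 := by
  simp only [heightDiff, incl, neg_lor_origin, graphParam, rotational, sub_self]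

theorem isUnitNormal_graphNormal (hG : HasTwoDerivs G a b) (ha : Continuous a)
    (hb : ContinuousOn b (Set.Ici 1)) :
    IsUnitNormal (𝓡 2) (graphParam (rotational G)) (graphNormal a) where
  continuous := continuous_graphNormal ha
  tangent p := by
    change lor ((_ : ℝ) • (graphGradient a p).1) (hypParam p).1 = 0
    rw [lor_smul_left, lor_graphGradient, mul_zero]
  normal p j := by
    have hL : ContDiffAt ℝ 2 (fun x => incl (graphParam (rotational G) x)) p :=
      (contDiff_graphParam hG hb).contDiffAt
    -- On the graph `z - G(f)` vanishes identically, so every point is an extremum and the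
    -- differential is zero; its gradient is thus normal to the graph.
    have h1 := fderiv_of_isLocalExtr (o := origin) hG hL
      (fun y => one_le_neg_lor (hypParam y).2.1 (hypParam y).2.2 origin.2.1 origin.2.2)
      (Or.inl (Filter.Eventually.of_forall fun y => by
        simp only [heightDiff_graphParam]; exact le_rfl)) (EuclideanSpace.single j 1)
    have h2 := lor_fderiv_eq_zero (hL.differentiableAt two_ne_zero) (fun y => (hypParam y).2.1)
      (EuclideanSpace.single j 1)
    rw [graphNormal, prodForm_smul_left, frame_eq (by simp), localRep_graphParam]
    refine mul_eq_zero_of_right _ ?_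
    change _ = a (-lor (hypParam p).1 origin.1) * _ at h1
    rw [neg_lor_origin] at h1
    change lor _ (hypParam p).1 = 0 at h2
    simp only [extChartAt_model_space_eq_id, PartialEquiv.refl_coe, id]
    generalize fderiv ℝ (fun x => incl (graphParam (rotational G) x)) p
      (EuclideanSpace.single j 1) = w at h1 h2 ⊢
    simp only [prodForm, graphGradient, lor, origin, Pi.smul_apply, Pi.sub_apply, smul_eq_mul,
      Matrix.cons_val] at h1 h2 ⊢
    linear_combination h1 - a ((hypParam p).1 2) * (hypParam p).1 2 * h2
  unit p := by
    have h := prodForm_graphGradient_pos a p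
    rw [graphNormal, prodForm_smul_left, prodForm_comm _ ((√ _)⁻¹ • _),
      prodForm_smul_left, ← mul_assoc,
      ← mul_inv, Real.mul_self_sqrt h.le, inv_mul_cancel₀ h.ne']

theorem isBowlSoliton_rotational (hG : HasTwoDerivs G a b) (ha : Continuous a)
    (hb : ContinuousOn b (Set.Ici 1)) (hd : ∀ c, 1 ≤ c → defect (a c) (b c) c = 0) :
    IsBowlSoliton (rotational G) where
  rotational θ p := by simp [TranslatingSoliton.rotational, rot]
  soliton := by
    have hs := isImmersedSurface_graphParam hG hb
    have hn := isUnitNormal_graphNormal hG ha hb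
    refine ⟨graphNormal a, ⟨hs, hn, fun p => ?_⟩, fun x => ?_⟩
    · exact meanCurvature_eq_of_heightDiff_eq (o := origin) hs hn (by simp) hG
        heightDiff_graphParam hd
    · rw [graphNormal, prodForm_smul_left]
      have : prodForm (graphGradient a x) vertical = 1 := by
        simp [prodForm, vertical, graphGradient, lor]
      rw [this, mul_one]
      exact inv_pos.2 (Real.sqrt_pos.2 (prodForm_graphGradient_pos a x))

end Graph

theorem exists_isBowlSoliton : ∃ u : HypPlane → ℝ, IsBowlSoliton u := by
  obtain ⟨h, h', hc, hd, hc', hdef⟩ := exists_profile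
  have hG : HasTwoDerivs (fun c => ∫ s in (1 : ℝ)..c, h s) h h' :=
    ⟨fun c _ => (hc.integral_hasStrictDerivAt 1 c).hasDerivAt.hasDerivWithinAt, hd⟩
  exact ⟨_, isBowlSoliton_rotational hG hc hc' hdef⟩

end TranslatingSoliton

end

theorem mainTheorem8 :
    (∃ u : HypPlane → ℝ, IsBowlSoliton u) ∧
    ∀ u : HypPlane → ℝ, IsBowlSoliton u →
    ∀ (M : Type*) [TopologicalSpace M] [T2Space M] [CompactSpace M] [ConnectedSpace M]
      [ChartedSpace (EuclideanHalfSpace 2) M] [IsManifold (𝓡∂ 2) 2 M]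
      (ψ : M → HypPlane × ℝ) (Γ : Set (HypPlane × ℝ)) (t₀ σ : ℝ),
      IsTranslatingSoliton (𝓡∂ 2) ψ →
      IsClosedCurve Γ → Γ ⊆ slice t₀ → diameter Γ = σ →
      ψ '' (𝓡∂ 2).boundary M = Γ →
      ∀ p : M, distToSet (ψ p) (slice t₀) ≤ bowlHeight u (2 * σ) := by
  refine ⟨exists_isBowlSoliton, ?_⟩
  intro u hu M _ _ _ _ _ _ ψ Γ t₀ σ hs hΓ hΓt hσ hb p
  rw [← hσ]
  exact distToSet_le_bowlHeight hu hs hΓ hΓt hb p
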